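/- Let $g\in C^1(\mathbb R)$ be periodic with period $T>0$, of mean zero ($\int_0^T g=0$), and not identically zero. Let $g_1,g_2,g_3$ be the unique $T$-periodic functions of mean zero with $g_1'=g$, $g_2'=g_1$, $g_3'=g_2$. For an integer $n\ge 1$ let $\varphi_1(r)=c_0\,r^{-\frac{n-2}{2}}J_{\frac{n-2}{2}}(\nu_1 r)$ be the principal Dirichlet eigenfunction of the Laplacian on the unit ball of $\mathbb R^n$, where $\nu_1>0$ is the first positive root of the Bessel function $J_{\frac{n-2}{2}}$ and $c_0$ is chosen so that $\varphi_1(0)=1$. Put $$f_1(r)=\frac{r^{n-1}\varphi_1(r)}{\varphi_1'(r)},\qquad f_2(r)=\frac{f_1'(r)}{\varphi_1'(r)},\qquad f_3(r)=\frac{f_2'(r)}{\varphi_1'(r)},\qquad K(\xi)=\int_0^1 g(\xi\varphi_1(r))\,\varphi_1(r)\,r^{n-1}\,dr .$$ A function $F$ is said to change sign infinitely many times if there are $0<x_1<x_2<\cdots\to\infty$ with $F(x_k)F(x_{k+1})<0$ for all $k$, and to have only finitely many sign changes if there is $M$ such that $F$ does not take values of opposite strict signs on $(M,\infty)$ (so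 sign changes are counted as $\xi\to\infty$). Then: (i) For $1\le n\le 3$, $K(\xi)$ changes sign infinitely many times. (ii) For $n=4$, let $C(\xi)=-\frac{1}{\varphi_1'(1)}g_2(0)+\frac{2}{\varphi_1''(0)^2}g_2(\xi)$. If $C$ changes sign infinitely many times (which is the case when $g_2(0)=0$), then $K(\xi)$ changes sign infinitely many times. If $C$ has no zeros on $(0,\infty)$, then $K(\xi)$ has only finitely many sign changes. (iii) For $n=5$, $K(\xi)$ has only finitely many sign changes if $g_2(0)\ne 0$, and changes sign infinitely many times if $g_2(0)=0$. (iv) For $n=6$, $K(\xi)$ has only finitely many sign changes if $g_2(0)\neq 0$. The limit $f_3(0):=\lim_{r\to0^+}f_3(r)$ exists; let $D(\xi)=f_3(1)g_3(0)-f_3(0)g_3(\xi)$ and suppose $g_2(0)=0$. If $D$ changes sign infinitely many times (which is the case when $g_3(0)=0$), then $K(\xi)$ changes sign infinitely many times. If $D$ has no zeros on $(0,\infty)$, then $K(\xi)$ has only finitely many sign changes. (v) For $n\ge 7$, if $g_2(0)=0$ and $g_3(0)\ne 0$, then $K(\xi)$ has only finitely many sign changes. -/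

import Mathlib

open Filter Topology

/-- The Bessel function of the first kind `J_ν(x)`, used for `x > 0`. -/
noncomputable def besselJ (ν x : ℝ) : ℝ :=
  ∑' k : ℕ, (-1 : ℝ) ^ k / ((k.factorial : ℝ) * Real.Gamma (k + ν + 1)) *
    (x / 2) ^ (2 * (k : ℝ) + ν)

/-- The first positive root `ν₁` of `J_{(n-2)/2}`. -/
noncomputable def nuOne (n : ℕ) : ℝ :=
  sInf {x : ℝ | 0 < x ∧ besselJ (((n : ℝ) - 2) / 2) x = 0}

/-- The even entire function `Γ(n/2) (x/2)^{-(n-2)/2} J_{(n-2)/2}(x)`, equal to `1` at `x = 0`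
(see `besselProfile_eq` and `besselProfile_zero`). -/
noncomputable def besselProfile (n : ℕ) (x : ℝ) : ℝ :=
  ∑' k : ℕ, (-1 : ℝ) ^ k * Real.Gamma ((n : ℝ) / 2) /
    ((k.factorial : ℝ) * Real.Gamma (k + (n : ℝ) / 2)) * (x / 2) ^ (2 * k)

theorem besselProfile_eq (n : ℕ) {x : ℝ} (hx : 0 < x) :
    besselProfile n x = Real.Gamma ((n : ℝ) / 2) * (x / 2) ^ (-(((n : ℝ) - 2) / 2)) *
      besselJ (((n : ℝ) - 2) / 2) x := by
  unfold besselProfile besselJ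
  rw [← tsum_mul_left]
  refine tsum_congr fun k => ?_
  have hx2 : 0 < x / 2 := by positivity
  have h1 : (x / 2) ^ (-(((n : ℝ) - 2) / 2)) * (x / 2) ^ (2 * (k : ℝ) + ((n : ℝ) - 2) / 2)
      = (x / 2) ^ (2 * k) := by
    rw [← Real.rpow_add hx2, ← Real.rpow_natCast]
    congr 1
    push_cast
    ring
  have h2 : (k : ℝ) + ((n : ℝ) - 2) / 2 + 1 = k + (n : ℝ) / 2 := by ring
  rw [h2, ← h1]
  ring

theorem besselProfile_zero {n : ℕ} (hn : 1 ≤ n) : besselProfile n 0 = 1 := by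
  have hn' : (0 : ℝ) < (n : ℝ) / 2 := by
    have : (0 : ℝ) < n := by exact_mod_cast hn
    positivity
  unfold besselProfile
  rw [tsum_eq_single 0]
  · simp [(Real.Gamma_pos_of_pos hn').ne']
  · intro k hk
    simp [hk]

/-- The principal Dirichlet eigenfunction of the Laplacian on the unit ball of `ℝⁿ`, as a function
of the radius: `φ₁(r) = c₀ r^{-(n-2)/2} J_{(n-2)/2}(ν₁ r)`, with `c₀` chosen so that `φ₁(0) = 1`. -/
noncomputable def phiOne (n : ℕ) (r : ℝ) : ℝ := besselProfile n (nuOne n * r)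

/-- The oscillating integral `K(ξ)`. -/
noncomputable def oscK (n : ℕ) (g : ℝ → ℝ) (ξ : ℝ) : ℝ :=
  ∫ r in (0 : ℝ)..1, g (ξ * phiOne n r) * phiOne n r * r ^ (n - 1)

/-- `f₁ = φ₁ r^{n-1} / φ₁'`. The values of `f₁`, `f₂`, `f₃` at `r = 0`, where `φ₁' = 0`, are
to be understood as limits for `r → 0+`. -/
noncomputable def fOne (n : ℕ) (r : ℝ) : ℝ :=
  phiOne n r * r ^ (n - 1) / deriv (phiOne n) r

/-- `f₂ = f₁' / φ₁'`. -/
noncomputable def fTwo (n : ℕ) (r : ℝ) : ℝ := deriv (fOne n) r / deriv (phiOne n) r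

/-- `f₃ = f₂' / φ₁'`. -/
noncomputable def fThree (n : ℕ) (r : ℝ) : ℝ := deriv (fTwo n) r / deriv (phiOne n) r

/-- The antiderivative of `h` with mean zero over `[0, T]`. For continuous `T`-periodic `h` of
mean zero it is the unique `T`-periodic function of mean zero whose derivative is `h`. -/
noncomputable def meanZeroPrimitive (T : ℝ) (h : ℝ → ℝ) (u : ℝ) : ℝ :=
  (∫ t in (0 : ℝ)..u, h t) - (1 / T) * ∫ s in (0 : ℝ)..T, ∫ t in (0 : ℝ)..s, h t

theorem meanZeroPrimitive_spec {T : ℝ} (hT : 0 < T) {h : ℝ → ℝ} (hc : Continuous h)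
    (hp : Function.Periodic h T) (hm : ∫ t in (0 : ℝ)..T, h t = 0) :
    (∀ u, HasDerivAt (meanZeroPrimitive T h) (h u) u) ∧
      Function.Periodic (meanZeroPrimitive T h) T ∧
      ∫ u in (0 : ℝ)..T, meanZeroPrimitive T h u = 0 := by
  have hd : ∀ u, HasDerivAt (fun u => ∫ t in (0 : ℝ)..u, h t) (h u) u := fun u =>
    hc.integral_hasStrictDerivAt 0 u |>.hasDerivAt
  have hcont : Continuous (fun u => ∫ t in (0 : ℝ)..u, h t) :=
    continuous_iff_continuousAt.2 fun u => (hd u).continuousAt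
  refine ⟨fun u => (hd u).sub_const _, fun u => ?_, ?_⟩
  · have h1 := intervalIntegral.integral_add_adjacent_intervals
      (hc.intervalIntegrable (μ := MeasureTheory.volume) 0 u) (hc.intervalIntegrable u (u + T))
    have h2 := hp.intervalIntegral_add_eq u 0
    rw [zero_add] at h2
    simp only [meanZeroPrimitive]
    rw [← h1, h2, hm, add_zero]
  · simp only [meanZeroPrimitive]
    rw [intervalIntegral.integral_sub (hcont.intervalIntegrable _ _) (by simp)]
    rw [intervalIntegral.integral_const, smul_eq_mul]
    field_simp
    ring

/-- `F` changes sign infinitely many times as `ξ → ∞`. -/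
def ChangesSignInfinitelyOften (F : ℝ → ℝ) : Prop :=
  ∃ x : ℕ → ℝ, StrictMono x ∧ Tendsto x atTop atTop ∧
    ∀ k, 0 < x k ∧ F (x k) * F (x (k + 1)) < 0

/-- `F` has only finitely many sign changes as `ξ → ∞`: beyond some point it takes no two values
of opposite strict signs. -/
def OnlyFinitelyManySignChanges (F : ℝ → ℝ) : Prop :=
  ∃ M : ℝ, ∀ x > M, ∀ y > M, 0 ≤ F x * F y

/-- The comparison function for `n = 4`, with `g₂` as argument. -/
noncomputable def compareFour (g₂ : ℝ → ℝ) (ξ : ℝ) : ℝ :=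
  -(1 / deriv (phiOne 4) 1) * g₂ 0 + 2 / (deriv (deriv (phiOne 4)) 0) ^ 2 * g₂ ξ

/-- The comparison function for `n = 6`, with `g₃` and the value `c = f₃(0)` as arguments. -/
noncomputable def compareSix (c : ℝ) (g₃ : ℝ → ℝ) (ξ : ℝ) : ℝ :=
  fThree 6 1 * g₃ 0 - c * g₃ ξ

/-! Write `φ₁(r) = Φ(r²)`. The power series of the Bessel profile shows that `Φ` is smooth, and its
differential equation gives `Φ' < 0` on `[0, 1]`. So `K` is an oscillatory integral whose phase has
a single critical point, nondegenerate and at `r = 0`, and whose amplitude carries the factor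
`r^(n-1)`.

Each integration by parts against the phase gains a factor `1/ξ`, replaces `g` by its next mean-zero
primitive, and lowers the power of `r` by two: the amplitudes are `f_j(r) = r^(n-2j) A_j(r²)`. The
end `r = 1` contributes the constant `A_j(1) g_j(0)`, where `A₁(1) = 0` because `φ₁(1) = 0`, while
`A₂(1)` and `A₃(1)` are nonzero (for `n ≥ 2` in the case of `A₃`). The origin contributes a boundary
term `A_j(0) g_j(ξ)` only when the exponent `n - 2j` is zero.

For even `n ≤ 6` this yields `ξ^j K(ξ) = P(ξ) + o(1)` with `P` periodic, the remainder being
controlled by a Riemann–Lebesgue lemma (`RadialPhase.tendsto_integral_zero`); the sign behaviour of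
`K` is that of `P`. When a constant `A_j(1) g_j(0)` is nonzero and no term from the origin competes
with it, it fixes the sign of `K`.

For `n = 1, 3`, and for `n = 5` with `g₂(0) = 0`, what remains is exactly an integral `I(ξ) = ∫ h(ξ
Φ(r²)) w(r) dr` with `w(0) ≠ 0`, and an eventual sign has to be excluded
(`RadialPhase.not_eventually_nonneg_of_pos`). On the scale `r ~ ξ^(-1/2)`, and along `ξ = t + N T`,
the part near the origin converges to `G_R(t) = w(0) ∫₀^R h(t - cρ²) dρ` with `c = -Φ'(0)`, up to a
tail `O(1/R)`. If `w(0) > 0` and `I` were eventually nonnegative, `G_R` would have mean zero and be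
at least `-C/R`, hence be `O(1/R)` in mean; but its correlation with the primitive of `h` stays
above a positive constant (`PeriodicMeanZero.exists_le_integral_autocorrelation`). -/

/-! ### The Bessel profile as a power series -/

/-- Taylor coefficients of `besselProfile n` in the variable `x ^ 2`. -/
noncomputable def besselCoeff (n k : ℕ) : ℝ :=
  (-1 : ℝ) ^ k * Real.Gamma ((n : ℝ) / 2) /
    ((k.factorial : ℝ) * Real.Gamma (k + (n : ℝ) / 2)) * (1 / 4) ^ k

/-- The entire function `P` with `besselProfile n x = P (x ^ 2)`. -/
noncomputable def besselSeries (n : ℕ) (y : ℝ) : ℝ := ∑' k : ℕ, besselCoeff n k * y ^ k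

theorem besselProfile_eq_besselSeries (n : ℕ) (x : ℝ) :
    besselProfile n x = besselSeries n (x ^ 2) := by
  unfold besselProfile besselSeries besselCoeff
  refine tsum_congr fun k => ?_
  rw [mul_assoc _ ((1 / 4 : ℝ) ^ k), ← mul_pow, pow_mul]
  congr 2
  ring

theorem half_pos_of_one_le {n : ℕ} (hn : 1 ≤ n) : (0 : ℝ) < (n : ℝ) / 2 := by
  have : (0 : ℝ) < n := by exact_mod_cast hn
  positivity

theorem besselCoeff_zero {n : ℕ} (hn : 1 ≤ n) : besselCoeff n 0 = 1 := by
  have := (Real.Gamma_pos_of_pos (half_pos_of_one_le hn)).ne'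
  simp [besselCoeff, this]

theorem besselCoeff_succ {n : ℕ} (hn : 1 ≤ n) (k : ℕ) :
    ((k : ℝ) + 1) * besselCoeff n (k + 1) = -(1 / (2 * n)) * besselCoeff (n + 2) k := by
  have h0 := half_pos_of_one_le hn
  have hn0 : (n : ℝ) ≠ 0 := by intro h; simp [h] at h0
  have h1 : Real.Gamma (((n + 2 : ℕ) : ℝ) / 2) = (n : ℝ) / 2 * Real.Gamma ((n : ℝ) / 2) := by
    rw [← Real.Gamma_add_one h0.ne']; congr 1; push_cast; ring
  have h2 : Real.Gamma (((k + 1 : ℕ) : ℝ) + (n : ℝ) / 2)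
      = Real.Gamma ((k : ℝ) + ((n + 2 : ℕ) : ℝ) / 2) := by
    congr 1; push_cast; ring
  have h3 : Real.Gamma ((k : ℝ) + ((n + 2 : ℕ) : ℝ) / 2) ≠ 0 :=
    (Real.Gamma_pos_of_pos (by positivity)).ne'
  have hk : ((k : ℝ) + 1) ≠ 0 := by positivity
  have hf : (k.factorial : ℝ) ≠ 0 := by positivity
  unfold besselCoeff
  rw [h1, h2, Nat.factorial_succ]
  push_cast at h3 ⊢
  field_simp
  ring

theorem besselCoeff_add_two {n : ℕ} (hn : 1 ≤ n) (k : ℕ) :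
    ((n : ℝ) + 2 * k) * besselCoeff (n + 2) k = n * besselCoeff n k := by
  have h0 := half_pos_of_one_le hn
  have h1 : Real.Gamma (((n + 2 : ℕ) : ℝ) / 2) = (n : ℝ) / 2 * Real.Gamma ((n : ℝ) / 2) := by
    rw [← Real.Gamma_add_one h0.ne']; congr 1; push_cast; ring
  have h2 : Real.Gamma ((k : ℝ) + ((n + 2 : ℕ) : ℝ) / 2)
      = ((k : ℝ) + (n : ℝ) / 2) * Real.Gamma ((k : ℝ) + (n : ℝ) / 2) := by
    rw [← Real.Gamma_add_one (by positivity)]; congr 1; push_cast; ring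
  have h3 : Real.Gamma ((k : ℝ) + (n : ℝ) / 2) ≠ 0 :=
    (Real.Gamma_pos_of_pos (by positivity)).ne'
  have h4 : (k : ℝ) + (n : ℝ) / 2 ≠ 0 := by positivity
  have hf : (k.factorial : ℝ) ≠ 0 := by positivity
  unfold besselCoeff
  rw [h1, h2]
  have h5 : (k : ℝ) * 2 + n ≠ 0 := by
    intro h; apply h4; linarith
  field_simp
  ring

/-- The two coefficient relations combine to `2(k+1)(n+2k) c_{k+1} = -c_k`, and `2(n+2k) ≥ 1`.
Domination by the exponential series then justifies every termwise operation below. -/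
theorem abs_besselCoeff_le {n : ℕ} (hn : 1 ≤ n) (k : ℕ) :
    |besselCoeff n k| ≤ 1 / (k.factorial : ℝ) := by
  induction k with
  | zero => simp [besselCoeff_zero hn]
  | succ k ih =>
    have h1 := besselCoeff_succ hn k
    have h2 := besselCoeff_add_two hn k
    have hn1 : (1 : ℝ) ≤ n := by exact_mod_cast hn
    have hk0 : (0 : ℝ) ≤ k := by positivity
    have h3 : besselCoeff n (k + 1) * (2 * (k + 1) * (n + 2 * k)) = - besselCoeff n k := by
      have : (n : ℝ) ≠ 0 := by positivity
      field_simp at h1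
      have h4 : (n : ℝ) * (besselCoeff n (k + 1) * (2 * (k + 1) * (n + 2 * k)))
          = n * -besselCoeff n k := by
        linear_combination ((n : ℝ) + 2 * k) * h1 - h2
      exact mul_left_cancel₀ this h4
    have h5 : |besselCoeff n (k + 1)| * (2 * (k + 1) * (n + 2 * k)) = |besselCoeff n k| := by
      rw [← abs_neg (besselCoeff n k), ← h3, abs_mul, abs_of_pos (a := 2 * ((k : ℝ) + 1) * _)]
      positivity
    have h6 : |besselCoeff n (k + 1)| * (k + 1) ≤ |besselCoeff n k| := by
      rw [← h5]
      gcongr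
      nlinarith
    rw [Nat.factorial_succ]
    push_cast
    rw [le_div_iff₀ (by positivity)]
    rw [le_div_iff₀ (by positivity)] at ih
    calc _ = |besselCoeff n (k + 1)| * (k + 1) * k.factorial := by ring
      _ ≤ |besselCoeff n k| * k.factorial := by gcongr
      _ ≤ 1 := ih

theorem summable_besselCoeff_mul_pow {n : ℕ} (hn : 1 ≤ n) (y : ℝ) :
    Summable fun k => besselCoeff n k * y ^ k := by
  refine Summable.of_norm_bounded (Real.summable_pow_div_factorial |y|) fun k => ?_
  rw [Real.norm_eq_abs, abs_mul, abs_pow, div_eq_mul_one_div, mul_comm]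
  gcongr
  exact abs_besselCoeff_le hn k

theorem hasDerivAt_besselSeries {n : ℕ} (hn : 1 ≤ n) (y : ℝ) :
    HasDerivAt (besselSeries n) (-(1 / (2 * n)) * besselSeries (n + 2) y) y := by
  set R := |y| + 1
  have hR : 0 ≤ R := by positivity
  have hs : Summable fun k : ℕ => (1 / (k.factorial : ℝ)) * (k * R ^ (k - 1)) := by
    rw [← summable_nat_add_iff 1]
    refine (Real.summable_pow_div_factorial R).congr fun k => ?_
    rw [Nat.factorial_succ]
    rw [Nat.add_sub_cancel]
    push_cast
    field_simp
  have h := hasDerivAt_tsum_of_isPreconnected (g := fun k y => besselCoeff n k * y ^ k)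
    (g' := fun k y => besselCoeff n k * (k * y ^ (k - 1))) (t := Metric.ball 0 R) (y₀ := 0)
    (y := y) hs Metric.isOpen_ball (convex_ball 0 R).isPreconnected
    (fun k z _ => (hasDerivAt_pow k z).const_mul _) (fun k z hz => ?_)
    (Metric.mem_ball_self (by positivity)) (summable_besselCoeff_mul_pow hn 0) ?_
  · refine h.congr_deriv ?_
    rw [Summable.tsum_eq_zero_add ?_]
    · simp only [CharP.cast_eq_zero, zero_mul, mul_zero, zero_add, Nat.add_sub_cancel]
      rw [besselSeries, ← tsum_mul_left]
      refine tsum_congr fun k => ?_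
      push_cast
      linear_combination y ^ k * besselCoeff_succ hn k
    · refine Summable.of_norm_bounded hs fun k => ?_
      rw [Real.norm_eq_abs, abs_mul, abs_mul, abs_pow, Nat.abs_cast]
      gcongr
      · exact abs_besselCoeff_le hn k
      · simp [R]
  · rw [Real.norm_eq_abs, abs_mul, abs_mul, abs_pow, Nat.abs_cast]
    gcongr
    · exact abs_besselCoeff_le hn k
    · simpa using (Metric.mem_ball.1 hz).le
  · simp [R]

/-- Differentiation only shifts `n` to `n + 2`, so the induction runs over all `n` at once. -/
theorem contDiff_besselSeries {n : ℕ} (hn : 1 ≤ n) : ContDiff ℝ (⊤ : ℕ∞) (besselSeries n) := by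
  refine contDiff_infty.2 fun m => ?_
  induction m generalizing n with
  | zero =>
    exact contDiff_zero.2 (continuous_iff_continuousAt.2 fun y =>
      (hasDerivAt_besselSeries hn y).continuousAt)
  | succ m ih =>
    push_cast
    refine contDiff_succ_iff_deriv.2
      ⟨fun y => (hasDerivAt_besselSeries hn y).differentiableAt, by simp, ?_⟩
    rw [show deriv (besselSeries n) = fun y => -(1 / (2 * n)) * besselSeries (n + 2) y from
      funext fun y => (hasDerivAt_besselSeries hn y).deriv]
    exact contDiff_const.mul (ih (by omega))

theorem besselSeries_zero {n : ℕ} (hn : 1 ≤ n) : besselSeries n 0 = 1 := by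
  have := besselProfile_eq_besselSeries n 0
  rw [besselProfile_zero hn] at this
  simpa using this.symm

theorem besselSeries_recurrence {n : ℕ} (hn : 1 ≤ n) (y : ℝ) :
    n * besselSeries (n + 2) y + 2 * y * deriv (besselSeries (n + 2)) y = n * besselSeries n y := by
  have hn2 : 1 ≤ n + 2 := by omega
  have hd : deriv (besselSeries (n + 2)) y
      = ∑' k : ℕ, ((k : ℝ) + 1) * besselCoeff (n + 2) (k + 1) * y ^ k := by
    rw [(hasDerivAt_besselSeries hn2 y).deriv, besselSeries, ← tsum_mul_left]
    refine tsum_congr fun k => ?_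
    rw [besselCoeff_succ hn2]
    ring
  have hsd : Summable fun k : ℕ => ((k : ℝ) + 1) * besselCoeff (n + 2) (k + 1) * y ^ k := by
    refine ((summable_besselCoeff_mul_pow (n := n + 2 + 2) (by omega) y).mul_left
      (-(1 / (2 * ((n + 2 : ℕ) : ℝ))))).congr fun k => ?_
    rw [besselCoeff_succ hn2]
    ring
  have hs2 : Summable fun k : ℕ => (k : ℝ) * besselCoeff (n + 2) k * y ^ k := by
    refine (summable_nat_add_iff 1).1 ((hsd.mul_left y).congr fun k => ?_)
    push_cast; ring
  have hyd : y * deriv (besselSeries (n + 2)) y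
      = ∑' k : ℕ, (k : ℝ) * besselCoeff (n + 2) k * y ^ k := by
    rw [Summable.tsum_eq_zero_add hs2, hd, ← tsum_mul_left]
    simp only [CharP.cast_eq_zero, zero_mul, zero_add]
    refine tsum_congr fun k => ?_
    push_cast; ring
  have hs1 := summable_besselCoeff_mul_pow hn2 y
  rw [mul_assoc, hyd]
  unfold besselSeries
  rw [← tsum_mul_left, ← tsum_mul_left, ← tsum_mul_left,
    ← (hs1.mul_left (n : ℝ)).tsum_add (hs2.mul_left 2)]
  refine tsum_congr fun k => ?_
  linear_combination y ^ k * besselCoeff_add_two hn k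

theorem besselSeries_ode {n : ℕ} (hn : 1 ≤ n) (y : ℝ) :
    4 * y * deriv (deriv (besselSeries n)) y + 2 * n * deriv (besselSeries n) y
      = - besselSeries n y := by
  have hd : deriv (besselSeries n) = fun y => -(1 / (2 * n)) * besselSeries (n + 2) y :=
    funext fun y => (hasDerivAt_besselSeries hn y).deriv
  have hdd : deriv (deriv (besselSeries n)) y
      = -(1 / (2 * n)) * deriv (besselSeries (n + 2)) y := by
    rw [hd]
    exact ((hasDerivAt_besselSeries (by omega) y).differentiableAt.hasDerivAt.const_mul _).deriv
  have h := besselSeries_recurrence hn y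
  have hn0 : (n : ℝ) ≠ 0 := by
    have : (0 : ℝ) < n := by exact_mod_cast hn
    exact this.ne'
  rw [hdd, hd]
  field_simp
  linear_combination -2 * h

/-! ### The first zero -/

/-- Without a zero, `u(r) = P(r²)` would be a positive radial solution of `Δu = -u` on all of space.
Green's identity with `v = (R² - r²)²`, which vanishes to second order at `r = R`, excludes this,
because `Δv + v > 0` for large `R`. -/
theorem exists_besselSeries_sq_eq_zero {n : ℕ} (hn : 1 ≤ n) :
    ∃ x : ℝ, 0 < x ∧ besselSeries n (x ^ 2) = 0 := by
  by_contra! hcon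
  have hP := contDiff_besselSeries hn
  have hpos : ∀ x : ℝ, 0 ≤ x → 0 < besselSeries n (x ^ 2) := by
    intro x hx
    by_contra! hle
    have hc : ContinuousOn (fun t : ℝ => besselSeries n (t ^ 2)) (Set.Icc 0 x) :=
      (hP.continuous.comp (continuous_pow 2)).continuousOn
    have h0 : besselSeries n ((0 : ℝ) ^ 2) = 1 := by simp [besselSeries_zero hn]
    obtain ⟨t, ht, ht0⟩ := intermediate_value_Icc' hx hc
      (⟨hle, zero_le_one.trans_eq h0.symm⟩ : (0 : ℝ) ∈ Set.Icc _ _)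
    rcases ht.1.eq_or_lt with h | h
    · subst h; simp only [h0] at ht0; norm_num at ht0
    · exact hcon t h ht0
  have hd1 : ∀ s, HasDerivAt (besselSeries n) (deriv (besselSeries n) s) s := fun s =>
    (hP.differentiable (by simp) s).hasDerivAt
  have hd2 : ∀ s, HasDerivAt (deriv (besselSeries n)) (deriv (deriv (besselSeries n)) s) s :=
    fun s => ((contDiff_infty_iff_deriv.1 hP).2.differentiable (by simp) s).hasDerivAt
  -- With `x = R² - r²`, `-(v + Δv) = -x² + (4n+8)x - 8R²`, whose maximum `(2n+4)² - 8R²` is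
  -- negative for this `R`.
  set R : ℝ := 4 * n + 8 with hR
  have hRpos : 0 < R := by positivity
  -- This is `r^(n-1) (v u' - u v')`, with derivative `-r^(n-1) u (v + Δv)`; it vanishes at both `0`
  -- and `R`.
  let G : ℝ → ℝ := fun r => r ^ n * (2 * (R ^ 2 - r ^ 2) ^ 2 * deriv (besselSeries n) (r ^ 2)
    + 4 * (R ^ 2 - r ^ 2) * besselSeries n (r ^ 2))
  have hG : ∀ r, HasDerivAt G (r ^ (n - 1) * besselSeries n (r ^ 2) *
      (-(R ^ 2 - r ^ 2) ^ 2 + 4 * n * (R ^ 2 - r ^ 2) - 8 * r ^ 2)) r := by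
    intro r
    have hs : HasDerivAt (fun r : ℝ => r ^ 2) (2 * r) r := by simpa using hasDerivAt_pow 2 r
    have e1 := (hd1 (r ^ 2)).comp r hs
    have e2 := (hd2 (r ^ 2)).comp r hs
    have e3 := hs.const_sub (R ^ 2)
    have e := (hasDerivAt_pow n r).mul
      ((((e3.pow 2).const_mul 2).mul e2).add ((e3.const_mul 4).mul e1))
    refine e.congr_deriv ?_
    simp only [Function.comp, Pi.mul_apply, Pi.add_apply, Pi.pow_apply]
    have ho := besselSeries_ode hn (r ^ 2)
    obtain ⟨m, rfl⟩ : ∃ m, n = m + 1 := ⟨n - 1, by omega⟩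
    simp only [Nat.add_sub_cancel, pow_succ r m]
    push_cast at ho ⊢
    linear_combination r ^ m * (R ^ 2 - r ^ 2) ^ 2 * ho
  have hanti : StrictAntiOn G (Set.Icc 0 R) := by
    refine strictAntiOn_of_deriv_neg (convex_Icc _ _)
      (fun r _ => (hG r).continuousAt.continuousWithinAt) fun r hr => ?_
    rw [interior_Icc] at hr
    rw [(hG r).deriv]
    refine mul_neg_of_pos_of_neg (mul_pos (pow_pos hr.1 _) (hpos r hr.1.le)) ?_
    have : 0 < R ^ 2 := by positivity
    nlinarith [sq_nonneg ((R ^ 2 - r ^ 2) - (2 * n + 4))]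
  have h0 : G 0 = 0 := by simp [G, show n ≠ 0 by omega]
  have h1 : G R = 0 := by simp [G]
  have := hanti (Set.left_mem_Icc.2 hRpos.le) (Set.right_mem_Icc.2 hRpos.le) hRpos
  linarith

/-- Since `P(0) = 1`, adding `0` to the domain creates no zero; the zero set is thus closed in `[0,
∞)` and the infimum is attained. Positivity before it is the intermediate value theorem. -/
theorem nuOne_spec {n : ℕ} (hn : 1 ≤ n) :
    0 < nuOne n ∧ besselSeries n (nuOne n ^ 2) = 0 ∧
      ∀ x, 0 ≤ x → x < nuOne n → 0 < besselSeries n (x ^ 2) := by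
  have hc : Continuous fun x : ℝ => besselSeries n (x ^ 2) :=
    (contDiff_besselSeries hn).continuous.comp (continuous_pow 2)
  have h0 : besselSeries n ((0 : ℝ) ^ 2) = 1 := by simp [besselSeries_zero hn]
  have hset : {x : ℝ | 0 < x ∧ besselJ (((n : ℝ) - 2) / 2) x = 0}
      = Set.Ici 0 ∩ (fun x : ℝ => besselSeries n (x ^ 2)) ⁻¹' {0} := by
    ext x
    simp only [Set.mem_ofPred_eq, Set.mem_inter_iff, Set.mem_Ici, Set.mem_preimage,
      Set.mem_singleton_iff]
    constructor
    · rintro ⟨hx, h⟩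
      refine ⟨hx.le, ?_⟩
      rw [← besselProfile_eq_besselSeries, besselProfile_eq n hx, h, mul_zero]
    · rintro ⟨hx, h⟩
      have hx' : 0 < x := by
        rcases hx.eq_or_lt with e | e
        · subst e; rw [h0] at h; norm_num at h
        · exact e
      refine ⟨hx', ?_⟩
      rw [← besselProfile_eq_besselSeries, besselProfile_eq n hx'] at h
      have h1 := (Real.Gamma_pos_of_pos (half_pos_of_one_le hn)).ne'
      have h2 : (x / 2) ^ (-(((n : ℝ) - 2) / 2)) ≠ 0 := by positivity
      simpa [h1, h2] using h
  have hclosed : IsClosed (Set.Ici 0 ∩ (fun x : ℝ => besselSeries n (x ^ 2)) ⁻¹' {0}) :=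
    isClosed_Ici.inter (isClosed_singleton.preimage hc)
  have hbdd : BddBelow (Set.Ici 0 ∩ (fun x : ℝ => besselSeries n (x ^ 2)) ⁻¹' {0}) :=
    ⟨0, fun x hx => hx.1⟩
  have hne : (Set.Ici 0 ∩ (fun x : ℝ => besselSeries n (x ^ 2)) ⁻¹' {0}).Nonempty := by
    obtain ⟨x, hx, h⟩ := exists_besselSeries_sq_eq_zero hn
    exact ⟨x, hx.le, h⟩
  have hmem := hclosed.csInf_mem hne hbdd
  rw [← hset] at hmem hbdd
  change nuOne n ∈ _ at hmem
  refine ⟨hmem.1, by rw [hset] at hmem; exact hmem.2, fun x hx hlt => ?_⟩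
  by_contra! hle
  obtain ⟨t, ht, ht0⟩ := intermediate_value_Icc' hx hc.continuousOn
    (⟨hle, zero_le_one.trans_eq h0.symm⟩ : (0 : ℝ) ∈ Set.Icc _ _)
  have : t ∈ {x : ℝ | 0 < x ∧ besselJ (((n : ℝ) - 2) / 2) x = 0} := by
    rw [hset]; exact ⟨ht.1, ht0⟩
  have := csInf_le hbdd this
  change nuOne n ≤ t at this
  linarith [ht.2]

/-! ### The eigenfunction in the variable `s = r²` -/

/-- The profile `Φ` with `φ₁(r) = Φ(r²)`. -/
noncomputable def radialProfile (n : ℕ) (s : ℝ) : ℝ := besselSeries n (nuOne n ^ 2 * s)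

theorem phiOne_eq (n : ℕ) (r : ℝ) : phiOne n r = radialProfile n (r ^ 2) := by
  rw [phiOne, besselProfile_eq_besselSeries, radialProfile, mul_pow]

theorem contDiff_radialProfile {n : ℕ} (hn : 1 ≤ n) : ContDiff ℝ (⊤ : ℕ∞) (radialProfile n) :=
  (contDiff_besselSeries hn).comp (contDiff_const.mul contDiff_id)

theorem contDiff_deriv_radialProfile {n : ℕ} (hn : 1 ≤ n) :
    ContDiff ℝ (⊤ : ℕ∞) (deriv (radialProfile n)) :=
  (contDiff_infty_iff_deriv.1 (contDiff_radialProfile hn)).2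

theorem hasDerivAt_radialProfile {n : ℕ} (hn : 1 ≤ n) (s : ℝ) :
    HasDerivAt (radialProfile n) (deriv (radialProfile n) s) s :=
  ((contDiff_radialProfile hn).differentiable (by simp) s).hasDerivAt

theorem hasDerivAt_deriv_radialProfile {n : ℕ} (hn : 1 ≤ n) (s : ℝ) :
    HasDerivAt (deriv (radialProfile n)) (deriv (deriv (radialProfile n)) s) s :=
  ((contDiff_deriv_radialProfile hn).differentiable (by simp) s).hasDerivAt

theorem radialProfile_zero {n : ℕ} (hn : 1 ≤ n) : radialProfile n 0 = 1 := by
  simp [radialProfile, besselSeries_zero hn]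

theorem radialProfile_one {n : ℕ} (hn : 1 ≤ n) : radialProfile n 1 = 0 := by
  simp [radialProfile, (nuOne_spec hn).2.1]

theorem radialProfile_sq_pos {n : ℕ} (hn : 1 ≤ n) {r : ℝ} (h0 : 0 ≤ r) (h1 : r < 1) :
    0 < radialProfile n (r ^ 2) := by
  have h := (nuOne_spec hn).1
  rw [radialProfile, ← mul_pow]
  exact (nuOne_spec hn).2.2 _ (by positivity) (by nlinarith)

theorem radialProfile_ode {n : ℕ} (hn : 1 ≤ n) (s : ℝ) :
    4 * s * deriv (deriv (radialProfile n)) s + 2 * n * deriv (radialProfile n) s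
      = - nuOne n ^ 2 * radialProfile n s := by
  have h1 : deriv (radialProfile n)
      = fun s => nuOne n ^ 2 * deriv (besselSeries n) (nuOne n ^ 2 * s) :=
    funext fun s => deriv_comp_mul_left (nuOne n ^ 2) (besselSeries n) s
  have h2 : deriv (deriv (radialProfile n)) s
      = nuOne n ^ 2 * (nuOne n ^ 2 * deriv (deriv (besselSeries n)) (nuOne n ^ 2 * s)) := by
    rw [h1, deriv_const_mul_field]
    congr 1
    exact deriv_comp_mul_left (nuOne n ^ 2) (deriv (besselSeries n)) s
  rw [h2, h1, radialProfile]
  linear_combination nuOne n ^ 2 * besselSeries_ode hn (nuOne n ^ 2 * s)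

/-- In divergence form the equation reads `(r^n Φ'(r²))' = -(ν₁²/2) r^(n-1) Φ(r²)`, which is
negative on `(0, 1)`. At `s = 0` the sign is read off the equation directly. -/
theorem deriv_radialProfile_neg {n : ℕ} (hn : 1 ≤ n) {s : ℝ} (hs : s ∈ Set.Icc (0 : ℝ) 1) :
    deriv (radialProfile n) s < 0 := by
  have hν := (nuOne_spec hn).1
  have hn0 : (0 : ℝ) < n := by exact_mod_cast hn
  rcases hs.1.eq_or_lt with h | h
  · subst h
    have := radialProfile_ode hn 0
    rw [radialProfile_zero hn] at this
    have h2 : 0 < nuOne n ^ 2 := by positivity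
    by_contra! h3
    nlinarith [mul_nonneg hn0.le h3]
  · let Q : ℝ → ℝ := fun r => r ^ n * deriv (radialProfile n) (r ^ 2)
    have hQ : ∀ r, HasDerivAt Q
        (-(nuOne n ^ 2 / 2) * (r ^ (n - 1) * radialProfile n (r ^ 2))) r := by
      intro r
      have hs : HasDerivAt (fun r : ℝ => r ^ 2) (2 * r) r := by simpa using hasDerivAt_pow 2 r
      refine ((hasDerivAt_pow n r).mul
        ((hasDerivAt_deriv_radialProfile hn (r ^ 2)).comp r hs)).congr_deriv ?_
      simp only [Function.comp]
      have ho := radialProfile_ode hn (r ^ 2)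
      obtain ⟨m, rfl⟩ : ∃ m, n = m + 1 := ⟨n - 1, by omega⟩
      simp only [Nat.add_sub_cancel, pow_succ r m]
      push_cast at ho ⊢
      linear_combination r ^ m / 2 * ho
    have hanti : StrictAntiOn Q (Set.Icc 0 1) := by
      refine strictAntiOn_of_deriv_neg (convex_Icc _ _)
        (fun r _ => (hQ r).continuousAt.continuousWithinAt) fun r hr => ?_
      rw [interior_Icc] at hr
      rw [(hQ r).deriv]
      exact mul_neg_of_neg_of_pos (by simp only [neg_lt_zero]; positivity)
        (mul_pos (pow_pos hr.1 _) (radialProfile_sq_pos hn hr.1.le hr.2))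
    have hsq : 0 < √s := Real.sqrt_pos.2 h
    have := hanti (Set.left_mem_Icc.2 zero_le_one)
      ⟨hsq.le, Real.sqrt_le_one.2 hs.2⟩ hsq
    simp only [Q, Real.sq_sqrt hs.1, show n ≠ 0 by omega, ne_eq, not_false_eq_true, zero_pow,
      zero_mul] at this
    exact (pos_iff_neg_of_mul_neg this).1 (pow_pos hsq n)

/-! ### Periodic functions of mean zero -/

/-- Continuous, `T`-periodic, of mean zero, and not identically zero. -/
structure PeriodicMeanZero (T : ℝ) (h : ℝ → ℝ) : Prop where
  continuous : Continuous h
  periodic : Function.Periodic h T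
  integral_eq_zero : ∫ t in (0 : ℝ)..T, h t = 0
  exists_ne_zero : ∃ x, h x ≠ 0

theorem Function.Periodic.exists_gt_eq {T : ℝ} (hT : 0 < T) {h : ℝ → ℝ}
    (hp : Function.Periodic h T) (x M : ℝ) : ∃ y > M, h y = h x := by
  obtain ⟨k, hk⟩ := exists_nat_gt ((M - x) / T)
  refine ⟨x + k * T, ?_, hp.nat_mul k x⟩
  rw [div_lt_iff₀ hT] at hk
  change M < _
  linarith

theorem Function.Periodic.exists_pos_bound {T : ℝ} (hT : 0 < T) {h : ℝ → ℝ}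
    (hp : Function.Periodic h T) (hc : Continuous h) : ∃ M, 0 < M ∧ ∀ x, |h x| ≤ M := by
  obtain ⟨M, hM⟩ := isCompact_Icc.exists_bound_of_continuousOn (s := Set.Icc 0 T) hc.continuousOn
  refine ⟨|M| + 1, by positivity, fun x => ?_⟩
  obtain ⟨y, hy, hxy⟩ := hp.exists_mem_Ico₀ hT x
  rw [hxy]
  have := hM y ⟨hy.1, hy.2.le⟩
  rw [Real.norm_eq_abs] at this
  linarith [le_abs_self M]

namespace PeriodicMeanZero

variable {T : ℝ} {h : ℝ → ℝ}

theorem neg (hh : PeriodicMeanZero T h) : PeriodicMeanZero T (fun x => -h x) where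
  continuous := hh.continuous.neg
  periodic := fun x => by simp [hh.periodic x]
  integral_eq_zero := by simp [hh.integral_eq_zero]
  exists_ne_zero := by simpa using hh.exists_ne_zero

theorem exists_pos (hh : PeriodicMeanZero T h) (hT : 0 < T) : ∃ x, 0 < h x := by
  by_contra! hle
  obtain ⟨x, hx⟩ := hh.exists_ne_zero
  obtain ⟨y, hy, hxy⟩ := hh.periodic.exists_mem_Ico₀ hT x
  have := intervalIntegral.integral_pos hT (f := fun t => -h t) hh.continuous.neg.continuousOn
    (fun t _ => by simpa using hle t)
    ⟨y, ⟨hy.1, hy.2.le⟩, by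
      rw [← hxy]; simpa using lt_of_le_of_ne (hle x) hx⟩
  rw [intervalIntegral.integral_neg, hh.integral_eq_zero] at this
  simp at this

theorem exists_neg (hh : PeriodicMeanZero T h) (hT : 0 < T) : ∃ x, h x < 0 := by
  obtain ⟨x, hx⟩ := hh.neg.exists_pos hT
  exact ⟨x, by simpa using hx⟩

theorem hasDerivAt_primitive (hh : PeriodicMeanZero T h) (hT : 0 < T) (u : ℝ) :
    HasDerivAt (meanZeroPrimitive T h) (h u) u :=
  (meanZeroPrimitive_spec hT hh.continuous hh.periodic hh.integral_eq_zero).1 u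

theorem primitive (hh : PeriodicMeanZero T h) (hT : 0 < T) :
    PeriodicMeanZero T (meanZeroPrimitive T h) where
  continuous := continuous_iff_continuousAt.2 fun u => (hh.hasDerivAt_primitive hT u).continuousAt
  periodic := (meanZeroPrimitive_spec hT hh.continuous hh.periodic hh.integral_eq_zero).2.1
  integral_eq_zero := (meanZeroPrimitive_spec hT hh.continuous hh.periodic hh.integral_eq_zero).2.2
  exists_ne_zero := by
    by_contra! hz
    obtain ⟨x, hx⟩ := hh.exists_ne_zero
    have h0 : meanZeroPrimitive T h = fun _ => 0 := funext hz
    have := hh.hasDerivAt_primitive hT x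
    rw [h0] at this
    exact hx (this.unique (hasDerivAt_const x 0))

end PeriodicMeanZero

/-! ### Sign changes and periodic asymptotics -/

theorem changesSignInfinitelyOften_of_frequently {F : ℝ → ℝ} (hp : ∀ M, ∃ x > M, 0 < F x)
    (hn : ∀ M, ∃ x > M, F x < 0) : ChangesSignInfinitelyOften F := by
  choose p hpM hpF using hp
  choose q hqM hqF using hn
  -- The next point is chosen with the opposite sign and more than one unit further, which forces
  -- divergence.
  let x : ℕ → ℝ := fun k =>
    Nat.rec (p 0) (fun _ y => if 0 < F y then q (y + 1) else p (y + 1)) k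
  have hsucc : ∀ k, x (k + 1) = if 0 < F (x k) then q (x k + 1) else p (x k + 1) := fun k => rfl
  have hlt : ∀ k, x k + 1 < x (k + 1) := by
    intro k
    rw [hsucc]
    split_ifs
    · exact hqM _
    · exact hpM _
  have hne : ∀ k, F (x k) ≠ 0 := by
    intro k
    cases k with
    | zero => exact (hpF 0).ne'
    | succ k =>
      rw [hsucc]
      split_ifs
      · exact (hqF _).ne
      · exact (hpF _).ne'
  have hge : ∀ k : ℕ, (k : ℝ) < x k := by
    intro k
    induction k with
    | zero => change ((0 : ℕ) : ℝ) < p 0; simpa using hpM 0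
    | succ k ih => push_cast; linarith [hlt k]
  refine ⟨x, strictMono_nat_of_lt_succ fun k => by linarith [hlt k],
    tendsto_atTop_mono (fun k => (hge k).le) tendsto_natCast_atTop_atTop, fun k => ⟨?_, ?_⟩⟩
  · exact lt_of_le_of_lt (by positivity) (hge k)
  · rw [hsucc]
    split_ifs with hk
    · exact mul_neg_of_pos_of_neg hk (hqF _)
    · exact mul_neg_of_neg_of_pos (lt_of_le_of_ne (not_lt.1 hk) (hne k)) (hpF _)

theorem ChangesSignInfinitelyOften.exists_pos_neg {F : ℝ → ℝ}
    (hF : ChangesSignInfinitelyOften F) : (∃ a, 0 < F a) ∧ ∃ b, F b < 0 := by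
  obtain ⟨x, -, -, hx⟩ := hF
  rcases mul_neg_iff.1 (hx 0).2 with h | h
  · exact ⟨⟨_, h.1⟩, ⟨_, h.2⟩⟩
  · exact ⟨⟨_, h.2⟩, ⟨_, h.1⟩⟩

theorem Function.Periodic.changesSignInfinitelyOften {T : ℝ} (hT : 0 < T) {P : ℝ → ℝ}
    (hP : Function.Periodic P T) (hp : ∃ a, 0 < P a) (hn : ∃ b, P b < 0) :
    ChangesSignInfinitelyOften P := by
  obtain ⟨a, ha⟩ := hp
  obtain ⟨b, hb⟩ := hn
  refine changesSignInfinitelyOften_of_frequently (fun M => ?_) (fun M => ?_)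
  · obtain ⟨y, hy, e⟩ := hP.exists_gt_eq hT a M
    exact ⟨y, hy, e ▸ ha⟩
  · obtain ⟨y, hy, e⟩ := hP.exists_gt_eq hT b M
    exact ⟨y, hy, e ▸ hb⟩

theorem PeriodicMeanZero.changesSignInfinitelyOften_const_mul {T : ℝ} {h : ℝ → ℝ}
    (hh : PeriodicMeanZero T h) (hT : 0 < T) {c : ℝ} (hc : c ≠ 0) :
    ChangesSignInfinitelyOften (fun x => c * h x) := by
  obtain ⟨a, ha⟩ := hh.exists_pos hT
  obtain ⟨b, hb⟩ := hh.exists_neg hT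
  have hper : Function.Periodic (fun x => c * h x) T := fun x => by simp only [hh.periodic x]
  rcases lt_or_gt_of_ne hc with h0 | h0
  · exact hper.changesSignInfinitelyOften hT ⟨b, mul_pos_of_neg_of_neg h0 hb⟩
      ⟨a, mul_neg_of_neg_of_pos h0 ha⟩
  · exact hper.changesSignInfinitelyOften hT ⟨a, mul_pos h0 ha⟩
      ⟨b, mul_neg_of_pos_of_neg h0 hb⟩

/-- Periodicity repeats a fixed positive and a fixed negative value of `P` arbitrarily far out,
where the error is smaller than both. -/
theorem ChangesSignInfinitelyOften.of_asymptotic {T : ℝ} (hT : 0 < T) {P F p : ℝ → ℝ}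
    (hP : Function.Periodic P T) (hch : ChangesSignInfinitelyOften P)
    (hp : ∀ ξ > 0, 0 < p ξ) (hlim : Tendsto (fun ξ => p ξ * F ξ - P ξ) atTop (𝓝 0)) :
    ChangesSignInfinitelyOften F := by
  obtain ⟨⟨a, ha⟩, b, hb⟩ := hch.exists_pos_neg
  refine changesSignInfinitelyOften_of_frequently (fun M => ?_) (fun M => ?_)
  · obtain ⟨N, hN⟩ := eventually_atTop.1 (hlim.eventually_const_lt (neg_lt_zero.2 ha))
    obtain ⟨y, hy, e⟩ := hP.exists_gt_eq hT a (max (max M N) 0)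
    obtain ⟨hy1, hy0⟩ := max_lt_iff.1 hy
    obtain ⟨hyM, hyN⟩ := max_lt_iff.1 hy1
    refine ⟨y, hyM, (pos_iff_pos_of_mul_pos ?_).1 (hp y hy0)⟩
    have := hN y hyN.le
    linarith
  · obtain ⟨N, hN⟩ := eventually_atTop.1 (hlim.eventually_lt_const (neg_pos.2 hb))
    obtain ⟨y, hy, e⟩ := hP.exists_gt_eq hT b (max (max M N) 0)
    obtain ⟨hy1, hy0⟩ := max_lt_iff.1 hy
    obtain ⟨hyM, hyN⟩ := max_lt_iff.1 hy1
    refine ⟨y, hyM, (pos_iff_neg_of_mul_neg ?_).1 (hp y hy0)⟩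
    have := hN y hyN.le
    linarith

theorem exists_forall_gt_pos_of_asymptotic {T : ℝ} (hT : 0 < T) {P F p : ℝ → ℝ}
    (hP : Function.Periodic P T) (hc : Continuous P) (hpos : ∀ ξ, 0 < P ξ)
    (hp : ∀ ξ > 0, 0 < p ξ) (hlim : Tendsto (fun ξ => p ξ * F ξ - P ξ) atTop (𝓝 0)) :
    ∃ M, ∀ x > M, 0 < F x := by
  obtain ⟨t, -, ht⟩ := isCompact_Icc.exists_isMinOn (s := Set.Icc 0 T)
    ⟨0, Set.left_mem_Icc.2 hT.le⟩ hc.continuousOn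
  obtain ⟨N, hN⟩ := eventually_atTop.1 (hlim.eventually_const_lt (neg_lt_zero.2 (hpos t)))
  refine ⟨max N 0, fun x hx => ?_⟩
  obtain ⟨hxN, hx0⟩ := max_lt_iff.1 hx
  obtain ⟨y, hy, hxy⟩ := hP.exists_mem_Ico₀ hT x
  refine (pos_iff_pos_of_mul_pos ?_).1 (hp x hx0)
  have h1 := hN x hxN.le
  have h2 : P t ≤ P y := ht ⟨hy.1, hy.2.le⟩
  rw [hxy] at h1
  linarith

/-- Periodicity carries nonvanishing from the half-line to the whole line, so `P` has one sign and,
by compactness of a period, stays away from zero. -/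
theorem OnlyFinitelyManySignChanges.of_asymptotic {T : ℝ} (hT : 0 < T) {P F p : ℝ → ℝ}
    (hP : Function.Periodic P T) (hc : Continuous P) (hne : ∀ ξ > 0, P ξ ≠ 0)
    (hp : ∀ ξ > 0, 0 < p ξ) (hlim : Tendsto (fun ξ => p ξ * F ξ - P ξ) atTop (𝓝 0)) :
    OnlyFinitelyManySignChanges F := by
  have hne' : ∀ ξ, P ξ ≠ 0 := by
    intro ξ
    obtain ⟨y, hy, e⟩ := hP.exists_gt_eq hT ξ 0
    exact e ▸ hne y hy
  have hsign : (∀ ξ, 0 < P ξ) ∨ ∀ ξ, P ξ < 0 := by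
    by_contra! hcon
    obtain ⟨⟨a, ha⟩, b, hb⟩ := hcon
    obtain ⟨c, hc0⟩ := mem_range_of_exists_le_of_exists_ge hc ⟨a, ha⟩ ⟨b, hb⟩
    exact hne' c hc0
  rcases hsign with h | h
  · obtain ⟨M, hM⟩ := exists_forall_gt_pos_of_asymptotic hT hP hc h hp hlim
    exact ⟨M, fun x hx y hy => (mul_pos (hM x hx) (hM y hy)).le⟩
  · obtain ⟨M, hM⟩ := exists_forall_gt_pos_of_asymptotic hT (P := fun ξ => -P ξ)
      (F := fun ξ => -F ξ) (fun x => by simp only [hP x]) hc.neg (fun ξ => neg_pos.2 (h ξ)) hp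
      (by simpa [neg_add_eq_sub, sub_eq_add_neg, add_comm] using hlim.neg)
    refine ⟨M, fun x hx y hy => (mul_pos_of_neg_of_neg ?_ ?_).le⟩
    · simpa using hM x hx
    · simpa using hM y hy

/-! ### Positivity of an autocorrelation integral -/

namespace PeriodicMeanZero

variable {T : ℝ} {h : ℝ → ℝ}

theorem abs_primitive_sub_le (hh : PeriodicMeanZero T h) (hT : 0 < T) {M : ℝ}
    (hM : ∀ x, |h x| ≤ M) (x y : ℝ) :
    |meanZeroPrimitive T h x - meanZeroPrimitive T h y| ≤ M * |x - y| := by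
  have := convex_univ.norm_image_sub_le_of_norm_hasDerivWithin_le (𝕜 := ℝ)
    (fun z _ => (hh.hasDerivAt_primitive hT z).hasDerivWithinAt) (fun z _ => hM z)
    (Set.mem_univ y) (Set.mem_univ x)
  simpa [Real.norm_eq_abs] using this

theorem integral_shift (hh : PeriodicMeanZero T h) (x : ℝ) :
    ∫ t in (0 : ℝ)..T, h (t - x) = 0 := by
  rw [intervalIntegral.integral_comp_sub_right, zero_sub, sub_eq_add_neg, add_comm T,
    hh.periodic.intervalIntegral_add_eq (-x) 0, zero_add, hh.integral_eq_zero]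

theorem integral_primitive_mul_shift (hh : PeriodicMeanZero T h) (hT : 0 < T) (x : ℝ) :
    ∫ t in (0 : ℝ)..T, meanZeroPrimitive T h (t - x) * h (t - x) = 0 := by
  have hd : ∀ t, HasDerivAt (fun t => meanZeroPrimitive T h (t - x) ^ 2 / 2)
      (meanZeroPrimitive T h (t - x) * h (t - x)) t := by
    intro t
    refine ((((hh.hasDerivAt_primitive hT (t - x)).comp_sub_const t x).pow 2).div_const 2
      ).congr_deriv ?_
    simp; ring
  have hc := hh.continuous
  have hc' := (hh.primitive hT).continuous
  rw [intervalIntegral.integral_eq_sub_of_hasDerivAt (fun t _ => hd t)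
    (Continuous.intervalIntegrable (by fun_prop) _ _)]
  have := (hh.primitive hT).periodic (0 - x)
  rw [show 0 - x + T = T - x by ring] at this
  rw [this, sub_self]

/-- Half the mean square increment of the primitive `H` of `h` for the shift `x`. -/
noncomputable def increment (T : ℝ) (h : ℝ → ℝ) (x : ℝ) : ℝ :=
  ∫ t in (0 : ℝ)..T, (meanZeroPrimitive T h t - meanZeroPrimitive T h (t - x)) ^ 2 / 2

/-- Differentiation under the integral gives `(H(t) - H(t-x)) h(t-x)`; the part `H(t-x) h(t-x)` is
the derivative of the periodic function `H(t-x)²/2` and integrates to zero. -/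
theorem hasDerivAt_increment (hh : PeriodicMeanZero T h) (hT : 0 < T) (x : ℝ) :
    HasDerivAt (increment T h) (∫ t in (0 : ℝ)..T, h (t - x) * meanZeroPrimitive T h t) x := by
  have hc := hh.continuous
  have hc' := (hh.primitive hT).continuous
  obtain ⟨M, hM0, hM⟩ := hh.periodic.exists_pos_bound hT hc
  obtain ⟨B, hB0, hB⟩ := (hh.primitive hT).periodic.exists_pos_bound hT hc'
  have key := (intervalIntegral.hasDerivAt_integral_of_dominated_loc_of_deriv_le
    (μ := MeasureTheory.volume) (a := 0) (b := T) (x₀ := x) (s := Set.univ)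
    (F := fun x t => (meanZeroPrimitive T h t - meanZeroPrimitive T h (t - x)) ^ 2 / 2)
    (F' := fun x t => (meanZeroPrimitive T h t - meanZeroPrimitive T h (t - x)) * h (t - x))
    (bound := fun _ => (B + B) * M) univ_mem
    (Eventually.of_forall fun x => (Continuous.aestronglyMeasurable (by fun_prop)))
    (Continuous.intervalIntegrable (by fun_prop) _ _)
    (Continuous.aestronglyMeasurable (by fun_prop))
    (Eventually.of_forall fun t _ x _ => ?_) (by simp)
    (Eventually.of_forall fun t _ x _ => ?_)).2
  · refine key.congr_deriv ?_
    have h0 := hh.integral_primitive_mul_shift hT x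
    have hs := intervalIntegral.integral_sub (μ := MeasureTheory.volume) (a := 0) (b := T)
      (f := fun t => h (t - x) * meanZeroPrimitive T h t)
      (g := fun t => meanZeroPrimitive T h (t - x) * h (t - x))
      (Continuous.intervalIntegrable (by fun_prop) _ _)
      (Continuous.intervalIntegrable (by fun_prop) _ _)
    rw [h0, sub_zero] at hs
    rw [← hs]
    exact intervalIntegral.integral_congr fun t _ => by ring
  · rw [norm_mul]
    exact mul_le_mul ((norm_sub_le _ _).trans (add_le_add (hB _) (hB _))) (hM _)
      (norm_nonneg _) (by positivity)
  · refine ((((hh.hasDerivAt_primitive hT (t - x)).comp_const_sub t x).const_sub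
      (meanZeroPrimitive T h t)).pow 2 |>.div_const 2).congr_deriv ?_
    simp; ring

theorem increment_nonneg (hT : 0 < T) (x : ℝ) : 0 ≤ increment T h x :=
  intervalIntegral.integral_nonneg hT.le fun _ _ => by positivity

theorem exists_increment_le (hh : PeriodicMeanZero T h) (hT : 0 < T) :
    ∃ K, ∀ x, increment T h x ≤ K * x ^ 2 := by
  have hc' := (hh.primitive hT).continuous
  obtain ⟨M, hM0, hM⟩ := hh.periodic.exists_pos_bound hT hh.continuous
  refine ⟨T * (M ^ 2 / 2), fun x => ?_⟩
  have : increment T h x ≤ ∫ t in (0 : ℝ)..T, (M * |x|) ^ 2 / 2 := by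
    refine intervalIntegral.integral_mono_on hT.le
      (Continuous.intervalIntegrable (by fun_prop) _ _) (by simp) fun t _ => ?_
    have := hh.abs_primitive_sub_le hT hM t (t - x)
    rw [sub_sub_cancel] at this
    have := (abs_le_abs_of_nonneg (abs_nonneg _) this)
    rw [abs_abs] at this
    have := sq_le_sq.2 (this)
    linarith
  refine this.trans_eq ?_
  simp [mul_pow]
  ring

theorem exists_increment_pos (hh : PeriodicMeanZero T h) (hT : 0 < T) :
    ∃ x > 0, 0 < increment T h x := by
  have hH := hh.primitive hT
  have hc' := hH.continuous
  obtain ⟨a', ha'⟩ := hH.exists_pos hT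
  obtain ⟨b, hb⟩ := hH.exists_neg hT
  obtain ⟨a, ha, e⟩ := hH.periodic.exists_mem_Ico₀ hT a'
  rw [e] at ha'
  -- Whole periods are added to make the shift from a negative to a positive value of the primitive
  -- positive.
  obtain ⟨k, hk⟩ := exists_nat_gt (b / T)
  rw [div_lt_iff₀ hT] at hk
  have e2 : meanZeroPrimitive T h (a - (a - b + k * T)) = meanZeroPrimitive T h b := by
    rw [show a - (a - b + k * T) = b - k * T by ring]
    exact hH.periodic.sub_nat_mul_eq k
  refine ⟨a - b + k * T, by linarith [ha.1], ?_⟩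
  refine intervalIntegral.integral_pos hT (by fun_prop) (fun _ _ => by positivity)
    ⟨a, ⟨ha.1, ha.2.le⟩, ?_⟩
  rw [e2]
  have : 0 < meanZeroPrimitive T h a - meanZeroPrimitive T h b := by linarith
  positivity

/-- Let `D` be `increment T h`. The integrand is `D'(cρ²)`, and integration by parts gives `∫₀^R
D'(cρ²) dρ = D(cR²)/(2cR) + ∫₀^R D(cρ²)/(2cρ²) dρ`. Both terms are nonnegative, and the last one
increases with `R` and is not identically zero. Below, `e` is the boundary term and `S` the last
integral. -/
theorem exists_le_integral_autocorrelation (hh : PeriodicMeanZero T h) (hT : 0 < T) {c : ℝ}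
    (hc : 0 < c) : ∃ κ > 0, ∃ R₀ > 0, ∀ R ≥ R₀, κ ≤ ∫ ρ in (0 : ℝ)..R,
      ∫ t in (0 : ℝ)..T, h (t - c * ρ ^ 2) * meanZeroPrimitive T h t := by
  have hcont := hh.continuous
  have hcont' := (hh.primitive hT).continuous
  set E : ℝ → ℝ := fun ρ => ∫ t in (0 : ℝ)..T, h (t - c * ρ ^ 2) * meanZeroPrimitive T h t with hE
  have hEc : Continuous E := by fun_prop
  set e : ℝ → ℝ := fun ρ => increment T h (c * ρ ^ 2) / (2 * c * ρ) with he
  set S : ℝ → ℝ := fun ρ => (∫ σ in (0 : ℝ)..ρ, E σ) - e ρ with hS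
  have hSd : ∀ ρ > 0, HasDerivAt S (increment T h (c * ρ ^ 2) / (2 * c * ρ ^ 2)) ρ := by
    intro ρ hρ
    have h1 : HasDerivAt (fun ρ : ℝ => c * ρ ^ 2) (c * (2 * ρ)) ρ := by
      simpa using (hasDerivAt_pow 2 ρ).const_mul c
    have h2 := (hh.hasDerivAt_increment hT (c * ρ ^ 2)).comp ρ h1
    have h3 : HasDerivAt (fun ρ : ℝ => 2 * c * ρ) (2 * c) ρ := by
      simpa using (hasDerivAt_id ρ).const_mul (2 * c)
    refine ((hEc.integral_hasStrictDerivAt 0 ρ).hasDerivAt.sub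
      (h2.div h3 (by positivity))).congr_deriv ?_
    simp only [Function.comp, hE]
    field_simp
    ring
  -- The quadratic bound on `increment` makes `e` of order `ρ³`, so the value `e 0 = 0` given by
  -- division by zero is the continuous one.
  have hec : Tendsto e (𝓝 0) (𝓝 0) := by
    obtain ⟨K, hK⟩ := hh.exists_increment_le hT
    have hlim : Tendsto (fun ρ : ℝ => |K * c / 2 * ρ ^ 3|) (𝓝 0) (𝓝 0) := by
      have : Continuous fun ρ : ℝ => |K * c / 2 * ρ ^ 3| := by fun_prop
      simpa using this.tendsto 0
    refine squeeze_zero_norm (fun ρ => ?_) hlim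
    rw [Real.norm_eq_abs]
    simp only [he]
    rcases eq_or_ne ρ 0 with rfl | hρ
    · simp
    · rw [abs_div, abs_of_nonneg (increment_nonneg hT _), div_le_iff₀ (by positivity), ← abs_mul]
      refine (hK _).trans ((le_abs_self _).trans_eq ?_)
      congr 1
      ring
  have hS0 : S 0 = 0 := by simp [hS, he]
  have hScont : ContinuousOn S (Set.Ici 0) := by
    intro ρ hρ
    rcases (Set.mem_Ici.1 hρ).eq_or_lt with h0 | h0
    · subst h0
      have he0 : ContinuousAt e 0 := by
        have : e 0 = 0 := by simp [he]
        rw [ContinuousAt, this]; exact hec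
      exact ((hEc.integral_hasStrictDerivAt 0 0).hasDerivAt.continuousAt.sub
        he0).continuousWithinAt
    · exact (hSd ρ h0).continuousAt.continuousWithinAt
  have hmono : MonotoneOn S (Set.Ici 0) := by
    refine monotoneOn_of_deriv_nonneg (convex_Ici 0) hScont ?_ ?_ <;> rw [interior_Ici]
    · exact fun ρ hρ => (hSd ρ hρ).differentiableAt.differentiableWithinAt
    · intro ρ hρ
      rw [(hSd ρ hρ).deriv]
      exact div_nonneg (increment_nonneg hT _) (by positivity)
  have hpos : ∃ R₀ > 0, 0 < S R₀ := by
    by_contra! hle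
    obtain ⟨x, hx, hxpos⟩ := hh.exists_increment_pos hT
    have hρ : 0 < √(x / c) := Real.sqrt_pos.2 (by positivity)
    -- A monotone `S` with no positive value is constant, so its derivative vanishes, contrary to a
    -- positive increment at `x = cρ²`.
    have hz : ∀ ρ > 0, S ρ = 0 := fun ρ hρ =>
      le_antisymm (hle ρ hρ) (hS0 ▸ hmono Set.self_mem_Ici (Set.mem_Ici.2 hρ.le) hρ.le)
    have h1 := hSd _ hρ
    have h2 : HasDerivAt S 0 √(x / c) :=
      (hasDerivAt_const _ (0 : ℝ)).congr_of_eventuallyEq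
        ((eventually_gt_nhds hρ).mono fun ρ h => hz ρ h)
    have h3 := h1.unique h2
    rw [Real.sq_sqrt (by positivity), mul_div_cancel₀ _ hc.ne'] at h3
    have : 0 < increment T h x / (2 * c * (x / c)) := by positivity
    exact this.ne' h3
  obtain ⟨R₀, hR₀, hSR⟩ := hpos
  refine ⟨S R₀, hSR, R₀, hR₀, fun R hR => ?_⟩
  have h1 : S R₀ ≤ S R :=
    hmono (Set.mem_Ici.2 hR₀.le) (Set.mem_Ici.2 (hR₀.le.trans hR)) hR
  have hRpos : 0 < R := hR₀.trans_le hR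
  have h2 : 0 ≤ e R := div_nonneg (increment_nonneg hT _) (by positivity)
  simp only [hS] at h1 ⊢
  linarith

end PeriodicMeanZero

/-! ### Oscillatory integrals with a radial phase -/

/-- Smoothness near each point of `[0, 1]`. -/
def SmoothOnUnit (f : ℝ → ℝ) : Prop := ∀ r ∈ Set.Icc (0 : ℝ) 1, ContDiffAt ℝ (⊤ : ℕ∞) f r

namespace SmoothOnUnit

variable {f g : ℝ → ℝ}

theorem _root_.ContDiff.smoothOnUnit (hf : ContDiff ℝ (⊤ : ℕ∞) f) : SmoothOnUnit f :=
  fun _ _ => hf.contDiffAt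

theorem mul (hf : SmoothOnUnit f) (hg : SmoothOnUnit g) : SmoothOnUnit (fun r => f r * g r) :=
  fun r hr => (hf r hr).mul (hg r hr)

theorem add (hf : SmoothOnUnit f) (hg : SmoothOnUnit g) : SmoothOnUnit (fun r => f r + g r) :=
  fun r hr => (hf r hr).add (hg r hr)

theorem div (hf : SmoothOnUnit f) (hg : SmoothOnUnit g) (h0 : ∀ r ∈ Set.Icc (0 : ℝ) 1, g r ≠ 0) :
    SmoothOnUnit (fun r => f r / g r) :=
  fun r hr => (hf r hr).div (hg r hr) (h0 r hr)

theorem neg (hf : SmoothOnUnit f) : SmoothOnUnit (fun r => -f r) :=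
  fun r hr => (hf r hr).neg

theorem deriv (hf : SmoothOnUnit f) : SmoothOnUnit (deriv f) :=
  fun r hr => ContDiffAt.derivWithin (hf r hr) (by simp)

theorem comp_sq (hf : SmoothOnUnit f) : SmoothOnUnit (fun r => f (r ^ 2)) := fun r hr =>
  ContDiffAt.comp (g := f) (f := fun r : ℝ => r ^ 2) r
    (hf (r ^ 2) ⟨by positivity, pow_le_one₀ hr.1 hr.2⟩) (contDiff_id.pow 2).contDiffAt

theorem hasDerivAt (hf : SmoothOnUnit f) {r : ℝ} (hr : r ∈ Set.Icc (0 : ℝ) 1) :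
    HasDerivAt f (_root_.deriv f r) r :=
  ((hf r hr).differentiableAt (by simp)).hasDerivAt

theorem continuousOn (hf : SmoothOnUnit f) : ContinuousOn f (Set.Icc 0 1) :=
  fun r hr => (hf r hr).continuousAt.continuousWithinAt

theorem exists_pos_bound (hf : SmoothOnUnit f) :
    ∃ M, 0 < M ∧ ∀ r ∈ Set.Icc (0 : ℝ) 1, |f r| ≤ M := by
  obtain ⟨M, hM⟩ := isCompact_Icc.exists_bound_of_continuousOn hf.continuousOn
  exact ⟨|M| + 1, by positivity, fun r hr =>
    (hM r hr).trans ((le_abs_self M).trans (by linarith))⟩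

end SmoothOnUnit

/-- The phases `r ↦ Φ (r ^ 2)` on `[0, 1]`, decreasing from the value `1` with a nondegenerate
critical point at the origin. -/
structure RadialPhase (Φ : ℝ → ℝ) : Prop where
  contDiff : ContDiff ℝ (⊤ : ℕ∞) Φ
  map_zero : Φ 0 = 1
  deriv_neg : ∀ s ∈ Set.Icc (0 : ℝ) 1, deriv Φ s < 0

theorem sq_mem_unit {r : ℝ} (hr : r ∈ Set.Icc (0 : ℝ) 1) : r ^ 2 ∈ Set.Icc (0 : ℝ) 1 :=
  ⟨by positivity, pow_le_one₀ hr.1 hr.2⟩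

namespace RadialPhase

variable {Φ : ℝ → ℝ}

theorem contDiff_deriv (hΦ : RadialPhase Φ) : ContDiff ℝ (⊤ : ℕ∞) (deriv Φ) :=
  (contDiff_infty_iff_deriv.1 hΦ.contDiff).2

theorem continuous (hΦ : RadialPhase Φ) : Continuous Φ := hΦ.contDiff.continuous

theorem hasDerivAt (hΦ : RadialPhase Φ) (s : ℝ) : HasDerivAt Φ (deriv Φ s) s :=
  (hΦ.contDiff.differentiable (by simp) s).hasDerivAt

theorem hasDerivAt_comp_sq (hΦ : RadialPhase Φ) (r : ℝ) :
    HasDerivAt (fun r => Φ (r ^ 2)) (2 * r * deriv Φ (r ^ 2)) r := by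
  have hs : HasDerivAt (fun r : ℝ => r ^ 2) (2 * r) r := by simpa using hasDerivAt_pow 2 r
  exact ((hΦ.hasDerivAt (r ^ 2)).comp r hs).congr_deriv (by ring)

/-- Integration by parts against the phase `r ↦ Φ (r ^ 2)`. -/
theorem integral_by_parts (hΦ : RadialPhase Φ) {H h f f' : ℝ → ℝ} (ξ a b : ℝ)
    (hH : ∀ x, HasDerivAt H (h x) x) (hh : Continuous h)
    (hf : ∀ r ∈ Set.uIcc a b, HasDerivAt f (f' r) r) (hf' : ContinuousOn f' (Set.uIcc a b)) :
    ξ * ∫ r in a..b, h (ξ * Φ (r ^ 2)) * (f r * (2 * r * deriv Φ (r ^ 2)))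
      = f b * H (ξ * Φ (b ^ 2)) - f a * H (ξ * Φ (a ^ 2))
        - ∫ r in a..b, H (ξ * Φ (r ^ 2)) * f' r := by
  have hc := hΦ.continuous
  have hc' := hΦ.contDiff_deriv.continuous
  have hv : ∀ r, HasDerivAt (fun r => H (ξ * Φ (r ^ 2)))
      (h (ξ * Φ (r ^ 2)) * (ξ * (2 * r * deriv Φ (r ^ 2)))) r := fun r =>
    (hH _).comp r ((hΦ.hasDerivAt_comp_sq r).const_mul ξ)
  have key := intervalIntegral.integral_mul_deriv_eq_deriv_mul hf (fun r _ => hv r)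
    hf'.intervalIntegrable (Continuous.intervalIntegrable (by fun_prop) _ _)
  rw [← intervalIntegral.integral_const_mul]
  refine (intervalIntegral.integral_congr fun r _ => ?_).trans (key.trans ?_)
  · ring
  · congr 1
    exact intervalIntegral.integral_congr fun r _ => mul_comm _ _

/-- Away from the origin one may divide by the derivative `2rΦ'(r²)` of the phase. The new amplitude
is `m(r)/r`, with derivative `O(1/r²)`, so boundary terms and remainder are all `O(1/δ)`. -/
theorem exists_tail_bound (hΦ : RadialPhase Φ) {T : ℝ} (hT : 0 < T) {h w : ℝ → ℝ}
    (hh : PeriodicMeanZero T h) (hw : SmoothOnUnit w) :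
    ∃ C, 0 < C ∧ ∀ ξ > 0, ∀ δ, 0 < δ → δ ≤ 1 →
      |∫ r in δ..1, h (ξ * Φ (r ^ 2)) * w r| ≤ C / (ξ * δ) := by
  have hdq : SmoothOnUnit fun r => 2 * deriv Φ (r ^ 2) :=
    (contDiff_const.smoothOnUnit).mul hΦ.contDiff_deriv.smoothOnUnit.comp_sq
  have hd0 : ∀ r ∈ Set.Icc (0 : ℝ) 1, 2 * deriv Φ (r ^ 2) ≠ 0 := fun r hr =>
    mul_ne_zero two_ne_zero (hΦ.deriv_neg _ (sq_mem_unit hr)).ne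
  set m : ℝ → ℝ := fun r => w r / (2 * deriv Φ (r ^ 2)) with hm
  have hmS : SmoothOnUnit m := hw.div hdq hd0
  obtain ⟨M, hM0, hM⟩ := hmS.exists_pos_bound
  obtain ⟨M', hM0', hM'⟩ := hmS.deriv.exists_pos_bound
  have hH := hh.primitive hT
  obtain ⟨B, hB0, hB⟩ := hH.periodic.exists_pos_bound hT hH.continuous
  refine ⟨2 * B * M + B * (M + M'), by positivity, fun ξ hξ δ hδ hδ1 => ?_⟩
  have hsub : Set.uIcc δ 1 ⊆ Set.Icc 0 1 := by
    rw [Set.uIcc_of_le hδ1]; exact Set.Icc_subset_Icc_left hδ.le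
  have hpos : ∀ r ∈ Set.uIcc δ 1, 0 < r := by
    rw [Set.uIcc_of_le hδ1]; exact fun r hr => hδ.trans_le hr.1
  have hf : ∀ r ∈ Set.uIcc δ 1, HasDerivAt (fun r => m r / r)
      ((deriv m r * r - m r) / r ^ 2) r := by
    intro r hr
    refine ((hmS.hasDerivAt (hsub hr)).div (hasDerivAt_id r) (hpos r hr).ne').congr_deriv ?_
    simp
  have hf' : ContinuousOn (fun r => (deriv m r * r - m r) / r ^ 2) (Set.uIcc δ 1) :=
    ((((hmS.deriv.continuousOn.mono hsub).mul continuousOn_id).sub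
      (hmS.continuousOn.mono hsub)).div (continuousOn_id.pow 2)
        fun r hr => (pow_pos (hpos r hr) 2).ne')
  have key := hΦ.integral_by_parts ξ δ 1 (hh.hasDerivAt_primitive hT) hh.continuous hf hf'
  have hint : ∫ r in δ..1, h (ξ * Φ (r ^ 2)) * (m r / r * (2 * r * deriv Φ (r ^ 2)))
      = ∫ r in δ..1, h (ξ * Φ (r ^ 2)) * w r := by
    refine intervalIntegral.integral_congr fun r hr => ?_
    have h1 := (hpos r hr).ne'
    have h2 := hd0 r (hsub hr)
    have h3 : deriv Φ (r ^ 2) ≠ 0 := fun h => h2 (by rw [h, mul_zero])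
    simp only [hm]
    field_simp
  rw [hint] at key
  have hδmem : δ ∈ Set.Icc (0 : ℝ) 1 := ⟨hδ.le, hδ1⟩
  have h1mem : (1 : ℝ) ∈ Set.Icc (0 : ℝ) 1 := ⟨zero_le_one, le_rfl⟩
  have b1 : |m 1 / 1 * meanZeroPrimitive T h (ξ * Φ (1 ^ 2))| ≤ B * M / δ := by
    rw [div_one, abs_mul, mul_comm]
    refine (mul_le_mul (hB _) (hM _ h1mem) (abs_nonneg _) hB0.le).trans ?_
    rw [le_div_iff₀ hδ]
    have : 0 < B * M := by positivity
    nlinarith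
  have b2 : |m δ / δ * meanZeroPrimitive T h (ξ * Φ (δ ^ 2))| ≤ B * M / δ := by
    rw [abs_mul, abs_div, abs_of_pos hδ, div_mul_eq_mul_div, mul_comm]
    gcongr
    · exact hB _
    · exact hM _ hδmem
  have hinv : ∀ r ∈ Set.uIcc δ 1, HasDerivAt (fun r : ℝ => -(B * (M + M')) * r⁻¹)
      (B * (M + M') / r ^ 2) r := fun r hr =>
    ((hasDerivAt_inv (hpos r hr).ne').const_mul _).congr_deriv (by ring)
  have hinvint : IntervalIntegrable (fun r : ℝ => B * (M + M') / r ^ 2)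
      MeasureTheory.volume δ 1 :=
    (continuousOn_const.div (continuousOn_id.pow 2)
      fun r hr => (pow_pos (hpos r hr) 2).ne').intervalIntegrable
  have b3 : |∫ r in δ..1, meanZeroPrimitive T h (ξ * Φ (r ^ 2)) *
      ((deriv m r * r - m r) / r ^ 2)| ≤ B * (M + M') / δ := by
    rw [← Real.norm_eq_abs]
    refine (intervalIntegral.norm_integral_le_of_norm_le hδ1
      (Eventually.of_forall fun r hr => ?_) hinvint).trans ?_
    · have hr' : r ∈ Set.Icc (0 : ℝ) 1 := ⟨hδ.le.trans hr.1.le, hr.2⟩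
      have hr0 : 0 < r := hδ.trans hr.1
      rw [Real.norm_eq_abs, abs_mul, abs_div, abs_of_pos (pow_pos hr0 2), mul_div_assoc]
      have : |deriv m r * r - m r| ≤ M + M' := by
        refine (abs_sub _ _).trans ?_
        rw [abs_mul, abs_of_pos hr0]
        have := hM r hr'
        have h5 := hM' r hr'
        nlinarith [abs_nonneg (deriv m r), hr'.2]
      gcongr
      exact hB _
    · rw [intervalIntegral.integral_eq_sub_of_hasDerivAt hinv hinvint]
      have : 0 < B * (M + M') := by positivity
      rw [div_eq_mul_inv]
      simp only [inv_one]
      linarith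
  have hfin : ξ * |∫ r in δ..1, h (ξ * Φ (r ^ 2)) * w r|
      ≤ (2 * B * M + B * (M + M')) / δ := by
    rw [← abs_of_pos hξ, ← abs_mul, abs_of_pos hξ, key]
    calc _ ≤ B * M / δ + B * M / δ + B * (M + M') / δ := by
          rw [abs_le] at b1 b2 b3 ⊢
          constructor <;> linarith
      _ = _ := by ring
  rw [mul_comm ξ δ, ← div_div, le_div_iff₀ hξ, mul_comm]
  exact hfin

/-- The cut at `δ = ξ^(-1/2)` balances the trivial bound `O(δ)` near the origin against the tail
bound `O(1/(ξδ))`. -/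
theorem exists_bound_div_sqrt (hΦ : RadialPhase Φ) {T : ℝ} (hT : 0 < T) {h w : ℝ → ℝ}
    (hh : PeriodicMeanZero T h) (hw : SmoothOnUnit w) :
    ∃ C, ∀ ξ ≥ 1, |∫ r in (0 : ℝ)..1, h (ξ * Φ (r ^ 2)) * w r| ≤ C / √ξ := by
  obtain ⟨C, hC0, hC⟩ := hΦ.exists_tail_bound hT hh hw
  obtain ⟨B, hB0, hB⟩ := hh.periodic.exists_pos_bound hT hh.continuous
  obtain ⟨W, hW0, hW⟩ := hw.exists_pos_bound
  have hc := hΦ.continuous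
  have hhc := hh.continuous
  refine ⟨B * W + C, fun ξ hξ => ?_⟩
  have hξ0 : 0 < ξ := by linarith
  have hs : 1 ≤ √ξ := Real.one_le_sqrt.2 hξ
  have hs0 : 0 < √ξ := by linarith
  have hδ1 : 1 / √ξ ≤ 1 := by rw [div_le_one hs0]; exact hs
  have hδ0 : 0 < 1 / √ξ := by positivity
  have hcont : ContinuousOn (fun r => h (ξ * Φ (r ^ 2)) * w r) (Set.Icc 0 1) :=
    ContinuousOn.mul (Continuous.continuousOn (by fun_prop)) hw.continuousOn
  have hi : ∀ a ∈ Set.Icc (0 : ℝ) 1, ∀ b ∈ Set.Icc (0 : ℝ) 1,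
      IntervalIntegrable (fun r => h (ξ * Φ (r ^ 2)) * w r) MeasureTheory.volume a b :=
    fun a ha b hb => (hcont.mono (Set.ordConnected_Icc.uIcc_subset ha hb)).intervalIntegrable
  rw [← intervalIntegral.integral_add_adjacent_intervals
    (hi 0 ⟨le_rfl, zero_le_one⟩ (1 / √ξ) ⟨hδ0.le, hδ1⟩) (hi _ ⟨hδ0.le, hδ1⟩ 1 ⟨zero_le_one, le_rfl⟩)]
  have h1 := hC ξ hξ0 (1 / √ξ) hδ0 hδ1
  have h2 : |∫ r in (0 : ℝ)..1 / √ξ, h (ξ * Φ (r ^ 2)) * w r| ≤ B * W * |1 / √ξ - 0| := by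
    rw [← Real.norm_eq_abs (intervalIntegral _ _ _ _)]
    refine intervalIntegral.norm_integral_le_of_norm_le_const fun r hr => ?_
    rw [Set.uIoc_of_le hδ0.le] at hr
    rw [norm_mul]
    exact mul_le_mul (hB _) (hW r ⟨hr.1.le, hr.2.trans hδ1⟩) (norm_nonneg _) hB0.le
  rw [sub_zero, abs_of_pos hδ0] at h2
  have h3 : ξ * (1 / √ξ) = √ξ := by
    rw [mul_one_div, Real.div_sqrt]
  rw [h3] at h1
  refine (abs_add_le _ _).trans ?_
  calc _ ≤ B * W * (1 / √ξ) + C / √ξ := add_le_add h2 h1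
    _ = _ := by ring

/-- The Riemann–Lebesgue lemma for the phase `r ↦ Φ (r ^ 2)`. -/
theorem tendsto_integral_zero (hΦ : RadialPhase Φ) {T : ℝ} (hT : 0 < T) {h w : ℝ → ℝ}
    (hh : PeriodicMeanZero T h) (hw : SmoothOnUnit w) :
    Tendsto (fun ξ => ∫ r in (0 : ℝ)..1, h (ξ * Φ (r ^ 2)) * w r) atTop (𝓝 0) := by
  obtain ⟨C, hC⟩ := hΦ.exists_bound_div_sqrt hT hh hw
  exact squeeze_zero_norm' ((eventually_ge_atTop 1).mono hC)
    (tendsto_const_nhds.div_atTop Real.tendsto_sqrt_atTop)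

end RadialPhase

/-! ### No eventual sign when the weight is nonzero at the origin -/

namespace RadialPhase

variable {Φ : ℝ → ℝ}

theorem tendsto_mul_sub_one (hΦ : RadialPhase Φ) (a : ℝ) :
    Tendsto (fun ξ => ξ * (Φ (a / ξ) - 1)) atTop (𝓝 (a * deriv Φ 0)) := by
  have h1 : HasDerivAt (fun x => Φ (a * x)) (a * deriv Φ 0) 0 := by
    have h2 : HasDerivAt (fun x : ℝ => a * x) a 0 := by simpa using (hasDerivAt_id 0).const_mul a
    have h3 : HasDerivAt Φ (deriv Φ 0) (a * 0) := by rw [mul_zero]; exact hΦ.hasDerivAt 0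
    exact (h3.comp 0 h2).congr_deriv (mul_comm _ _)
  have h4 : Tendsto (fun ξ : ℝ => ξ⁻¹) atTop (𝓝[≠] 0) :=
    tendsto_inv_atTop_nhdsGT_zero.mono_right (nhdsWithin_mono 0 fun x hx => (Set.mem_Ioi.1 hx).ne')
  refine ((hasDerivAt_iff_tendsto_slope_zero.1 h1).comp h4).congr fun ξ => ?_
  simp [hΦ.map_zero, div_eq_mul_inv]

/-- The contribution of the critical point at the origin, on the scale `r ~ ξ ^ (-1 / 2)`, along
a sequence `ξ = t + N T`. -/
theorem tendsto_rescaled_integral (hΦ : RadialPhase Φ) {T : ℝ} (hT : 0 < T) {h w : ℝ → ℝ}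
    (hh : PeriodicMeanZero T h) (hw : SmoothOnUnit w) (t : ℝ) {R : ℝ} (hR : 0 < R) :
    Tendsto (fun N : ℕ => √(t + N * T) *
        ∫ r in (0 : ℝ)..R / √(t + N * T), h ((t + N * T) * Φ (r ^ 2)) * w r) atTop
      (𝓝 (∫ ρ in (0 : ℝ)..R, h (t - -deriv Φ 0 * ρ ^ 2) * w 0)) := by
  obtain ⟨B, hB0, hB⟩ := hh.periodic.exists_pos_bound hT hh.continuous
  obtain ⟨W, hW0, hW⟩ := hw.exists_pos_bound
  have hc := hΦ.continuous
  have hhc := hh.continuous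
  have hξ : Tendsto (fun N : ℕ => t + N * T) atTop atTop :=
    tendsto_atTop_add_const_left _ t (tendsto_natCast_atTop_atTop.atTop_mul_const hT)
  have hs : Tendsto (fun N : ℕ => √(t + N * T)) atTop atTop := Real.tendsto_sqrt_atTop.comp hξ
  have hev : ∀ᶠ N : ℕ in atTop, 0 < √(t + N * T) ∧ R ≤ √(t + N * T) :=
    (hs.eventually_gt_atTop 0).and (hs.eventually_ge_atTop R)
  have hmem : ∀ N : ℕ, 0 < √(t + N * T) ∧ R ≤ √(t + N * T) → ∀ ρ ∈ Set.Icc 0 R,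
      ρ / √(t + N * T) ∈ Set.Icc (0 : ℝ) 1 := fun N hN ρ hρ =>
    ⟨div_nonneg hρ.1 hN.1.le, (div_le_one hN.1).2 (hρ.2.trans hN.2)⟩
  have hlim := intervalIntegral.tendsto_integral_filter_of_dominated_convergence
    (μ := MeasureTheory.volume) (a := 0) (b := R) (l := (atTop : Filter ℕ))
    (F := fun N ρ => h ((t + N * T) * Φ ((ρ / √(t + N * T)) ^ 2)) * w (ρ / √(t + N * T)))
    (f := fun ρ => h (t - -deriv Φ 0 * ρ ^ 2) * w 0) (fun _ => B * W) ?_ ?_ (by simp) ?_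
  · refine hlim.congr' (hev.mono fun N hN => ?_)
    have := intervalIntegral.integral_comp_div (a := 0) (b := R)
      (fun r => h ((t + N * T) * Φ (r ^ 2)) * w r) hN.1.ne'
    rw [zero_div, smul_eq_mul] at this
    exact this
  · refine hev.mono fun N hN => ?_
    rw [Set.uIoc_of_le hR.le]
    refine (ContinuousOn.mono ?_ Set.Ioc_subset_Icc_self).aestronglyMeasurable measurableSet_Ioc
    exact ContinuousOn.mul (Continuous.continuousOn (by fun_prop))
      (hw.continuousOn.comp (continuous_id.div_const _).continuousOn (hmem N hN))
  · refine hev.mono fun N hN => Eventually.of_forall fun ρ hρ => ?_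
    rw [Set.uIoc_of_le hR.le] at hρ
    rw [norm_mul]
    exact mul_le_mul (hB _) (hW _ (hmem N hN ρ ⟨hρ.1.le, hρ.2⟩)) (norm_nonneg _) hB0.le
  · refine Eventually.of_forall fun ρ _ => Tendsto.mul ?_ ?_
    · have h1 := (hΦ.tendsto_mul_sub_one (ρ ^ 2)).comp hξ
      have h2 := (hhc.tendsto (t - -deriv Φ 0 * ρ ^ 2)).comp
        ((tendsto_const_nhds (x := t)).add h1 |>.trans (by
          rw [show t - -deriv Φ 0 * ρ ^ 2 = t + ρ ^ 2 * deriv Φ 0 by ring]))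
      refine h2.congr' ((hξ.eventually_gt_atTop 0).mono fun N hN => ?_)
      -- Since `Φ(0) = 1`, the argument of `h` is `t + N T + ξ(Φ(ρ²/ξ) - 1)`; periodicity removes `N
      -- T` and the last term tends to `ρ² Φ'(0)`.
      simp only [Function.comp]
      rw [div_pow, Real.sq_sqrt hN.le, ← hh.periodic.nat_mul N]
      congr 1
      ring
    · have h1 : Tendsto (fun N : ℕ => ρ / √(t + N * T)) atTop (𝓝 0) :=
        tendsto_const_nhds.div_atTop hs
      exact ((hw 0 ⟨le_rfl, zero_le_one⟩).continuousAt.tendsto).comp h1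

/-- If the integral were nonnegative beyond `M`, its part near the origin would be at least minus
the tail, so `G R ≥ -C/R`. As `G R` has mean zero, its correlation with the bounded primitive would
be `O(1/R)`, against the lower bound `w 0 * κ`. -/
theorem not_eventually_nonneg_of_pos (hΦ : RadialPhase Φ) {T : ℝ} (hT : 0 < T) {h w : ℝ → ℝ}
    (hh : PeriodicMeanZero T h) (hw : SmoothOnUnit w) (hw0 : 0 < w 0) (M : ℝ) :
    ∃ ξ > M, ∫ r in (0 : ℝ)..1, h (ξ * Φ (r ^ 2)) * w r < 0 := by
  by_contra! hI
  obtain ⟨C, hC0, hC⟩ := hΦ.exists_tail_bound hT hh hw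
  have hH := hh.primitive hT
  obtain ⟨B, hB0, hB⟩ := hH.periodic.exists_pos_bound hT hH.continuous
  have hhc := hh.continuous
  have hHc := hH.continuous
  have hΦc := hΦ.continuous
  set c := -deriv Φ 0 with hc
  have hcpos : 0 < c := neg_pos.2 (hΦ.deriv_neg 0 ⟨le_rfl, zero_le_one⟩)
  obtain ⟨κ, hκ, R₀, hR₀, hκR⟩ := hh.exists_le_integral_autocorrelation hT hcpos
  set G : ℝ → ℝ → ℝ := fun R t => ∫ ρ in (0 : ℝ)..R, h (t - c * ρ ^ 2) * w 0 with hG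
  have hGc : ∀ R, Continuous (G R) := fun R => by fun_prop
  have hlower : ∀ R > 0, ∀ t, -(C / R) ≤ G R t := by
    intro R hR t
    refine ge_of_tendsto (hΦ.tendsto_rescaled_integral hT hh hw t hR) ?_
    have hξ : Tendsto (fun N : ℕ => t + N * T) atTop atTop :=
      tendsto_atTop_add_const_left _ t (tendsto_natCast_atTop_atTop.atTop_mul_const hT)
    have hs : Tendsto (fun N : ℕ => √(t + N * T)) atTop atTop := Real.tendsto_sqrt_atTop.comp hξ
    filter_upwards [hξ.eventually_gt_atTop M, hξ.eventually_gt_atTop 0, hs.eventually_ge_atTop R]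
      with N hNM hN0 hNR
    set ξ := t + N * T
    have hs0 : 0 < √ξ := Real.sqrt_pos.2 hN0
    have hδ0 : 0 < R / √ξ := by positivity
    have hδ1 : R / √ξ ≤ 1 := (div_le_one hs0).2 hNR
    have hcont : ContinuousOn (fun r => h (ξ * Φ (r ^ 2)) * w r) (Set.Icc 0 1) :=
      ContinuousOn.mul (Continuous.continuousOn (by fun_prop)) hw.continuousOn
    have hi : ∀ a ∈ Set.Icc (0 : ℝ) 1, ∀ b ∈ Set.Icc (0 : ℝ) 1,
        IntervalIntegrable (fun r => h (ξ * Φ (r ^ 2)) * w r) MeasureTheory.volume a b :=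
      fun a ha b hb => (hcont.mono (Set.ordConnected_Icc.uIcc_subset ha hb)).intervalIntegrable
    have h1 := hI ξ hNM
    rw [← intervalIntegral.integral_add_adjacent_intervals
      (hi 0 ⟨le_rfl, zero_le_one⟩ (R / √ξ) ⟨hδ0.le, hδ1⟩)
      (hi _ ⟨hδ0.le, hδ1⟩ 1 ⟨zero_le_one, le_rfl⟩)] at h1
    have h2 := (abs_le.1 (hC ξ hN0 (R / √ξ) hδ0 hδ1)).2
    -- The tail beyond `R/√ξ`, after rescaling by `√ξ`, is bounded uniformly in `ξ`.
    have h3 : √ξ * (C / (ξ * (R / √ξ))) = C / R := by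
      have := Real.mul_self_sqrt hN0.le
      field_simp
      rw [sq, this]
    rw [← h3, ← mul_neg]
    exact mul_le_mul_of_nonneg_left (by linarith) hs0.le
  have hmean : ∀ R, ∫ t in (0 : ℝ)..T, G R t = 0 := by
    intro R
    simp only [hG]
    rw [MeasureTheory.intervalIntegral_intervalIntegral_swap
      (F := fun t ρ => h (t - c * ρ ^ 2) * w 0)
      ((Continuous.integrableOn_Icc (a := ((min 0 T, min 0 R) : ℝ × ℝ)) (b := (max 0 T, max 0 R))
        (by fun_prop)).mono_set ?_)]
    · simp [hh.integral_shift]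
    · rw [← Set.Icc_prod_Icc]
      exact Set.prod_mono Set.Ioc_subset_Icc_self Set.Ioc_subset_Icc_self
  have hcorr : ∀ R ≥ R₀, w 0 * κ ≤ ∫ t in (0 : ℝ)..T, G R t * meanZeroPrimitive T h t := by
    intro R hR
    have h1 : ∫ t in (0 : ℝ)..T, G R t * meanZeroPrimitive T h t = w 0 * ∫ ρ in (0 : ℝ)..R,
        ∫ t in (0 : ℝ)..T, h (t - c * ρ ^ 2) * meanZeroPrimitive T h t := by
      rw [MeasureTheory.intervalIntegral_intervalIntegral_swap
        (F := fun ρ t => h (t - c * ρ ^ 2) * meanZeroPrimitive T h t)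
        ((Continuous.integrableOn_Icc (a := ((min 0 R, min 0 T) : ℝ × ℝ))
          (b := (max 0 R, max 0 T)) (by fun_prop)).mono_set ?_)]
      · rw [← intervalIntegral.integral_const_mul]
        refine intervalIntegral.integral_congr fun t _ => ?_
        simp only [hG]
        rw [← intervalIntegral.integral_mul_const, ← intervalIntegral.integral_const_mul]
        exact intervalIntegral.integral_congr fun ρ _ => by ring
      · rw [← Set.Icc_prod_Icc]
        exact Set.prod_mono Set.Ioc_subset_Icc_self Set.Ioc_subset_Icc_self
    rw [h1]
    exact mul_le_mul_of_nonneg_left (hκR R hR) hw0.le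
  have hbound : ∀ R ≥ R₀, w 0 * κ ≤ C / R * (B * T) := by
    intro R hR
    have hRpos : 0 < R := hR₀.trans_le hR
    have hGR := hGc R
    -- Both factors are nonnegative. Expanding, with `G R` and the primitive of mean zero, leaves `∫
    -- G R · H ≤ (C/R) B T`.
    have h0 : 0 ≤ ∫ t in (0 : ℝ)..T, (G R t + C / R) * (B - meanZeroPrimitive T h t) :=
      intervalIntegral.integral_nonneg hT.le fun t _ =>
        mul_nonneg (by linarith [hlower R hRpos t]) (by linarith [(abs_le.1 (hB t)).2])
    have h1 : ∫ t in (0 : ℝ)..T, (G R t + C / R) * (B - meanZeroPrimitive T h t)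
        = (∫ t in (0 : ℝ)..T, (B * G R t + C / R * B))
          - ∫ t in (0 : ℝ)..T, (G R t * meanZeroPrimitive T h t
            + C / R * meanZeroPrimitive T h t) := by
      rw [← intervalIntegral.integral_sub (Continuous.intervalIntegrable (by fun_prop) _ _)
        (Continuous.intervalIntegrable (by fun_prop) _ _)]
      exact intervalIntegral.integral_congr fun t _ => by ring
    rw [h1, intervalIntegral.integral_add (Continuous.intervalIntegrable (by fun_prop) _ _)
        (Continuous.intervalIntegrable (by fun_prop) _ _),
      intervalIntegral.integral_add (Continuous.intervalIntegrable (by fun_prop) _ _)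
        (Continuous.intervalIntegrable (by fun_prop) _ _),
      intervalIntegral.integral_const_mul, intervalIntegral.integral_const_mul,
      intervalIntegral.integral_const_mul, hmean R, hH.integral_eq_zero, intervalIntegral.integral_const, smul_eq_mul] at h0
    have := hcorr R hR
    linarith
  have hlim : Tendsto (fun R => C / R * (B * T)) atTop (𝓝 (0 * (B * T))) :=
    (tendsto_const_nhds.div_atTop tendsto_id).mul_const _
  rw [zero_mul] at hlim
  have := ge_of_tendsto hlim ((eventually_ge_atTop R₀).mono hbound)
  have : 0 < w 0 * κ := by positivity
  linarith

theorem changesSignInfinitelyOften_integral (hΦ : RadialPhase Φ) {T : ℝ} (hT : 0 < T)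
    {h w : ℝ → ℝ} (hh : PeriodicMeanZero T h) (hw : SmoothOnUnit w) (hw0 : w 0 ≠ 0) :
    ChangesSignInfinitelyOften fun ξ => ∫ r in (0 : ℝ)..1, h (ξ * Φ (r ^ 2)) * w r := by
  rcases lt_or_gt_of_ne hw0 with h0 | h0
  · refine changesSignInfinitelyOften_of_frequently (fun M => ?_) (fun M => ?_)
    · obtain ⟨ξ, h1, h2⟩ := hΦ.not_eventually_nonneg_of_pos hT hh hw.neg (neg_pos.2 h0) M
      exact ⟨ξ, h1, by simpa using h2⟩
    · obtain ⟨ξ, h1, h2⟩ := hΦ.not_eventually_nonneg_of_pos hT hh.neg hw.neg (neg_pos.2 h0) M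
      exact ⟨ξ, h1, by simpa using h2⟩
  · refine changesSignInfinitelyOften_of_frequently (fun M => ?_) (fun M => ?_)
    · obtain ⟨ξ, h1, h2⟩ := hΦ.not_eventually_nonneg_of_pos hT hh.neg hw h0 M
      exact ⟨ξ, h1, by simpa using h2⟩
    · exact hΦ.not_eventually_nonneg_of_pos hT hh hw h0 M

end RadialPhase

theorem radialPhase_radialProfile {n : ℕ} (hn : 1 ≤ n) : RadialPhase (radialProfile n) where
  contDiff := contDiff_radialProfile hn
  map_zero := radialProfile_zero hn
  deriv_neg := fun _ hs => deriv_radialProfile_neg hn hs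

theorem ChangesSignInfinitelyOften.of_mul_eq {F G p : ℝ → ℝ}
    (hG : ChangesSignInfinitelyOften G) (hp : ∀ ξ > 0, 0 < p ξ)
    (h : ∀ ξ > 0, p ξ * F ξ = G ξ) : ChangesSignInfinitelyOften F := by
  obtain ⟨x, hx1, hx2, hx3⟩ := hG
  refine ⟨x, hx1, hx2, fun k => ⟨(hx3 k).1, ?_⟩⟩
  have h1 := (hx3 k).2
  rw [← h _ (hx3 k).1, ← h _ (hx3 (k + 1)).1] at h1
  refine (pos_iff_neg_of_mul_neg (a := p (x k) * p (x (k + 1))) ?_).1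
    (mul_pos (hp _ (hx3 k).1) (hp _ (hx3 (k + 1)).1))
  linarith

/-! ### Repeated integration by parts -/

/-- If `f r = r ^ (k + 2) * A (r ^ 2)` and `φ r = Φ (r ^ 2)` then
`f' r / φ' r = r ^ k * nextAmp Φ (k + 2) A (r ^ 2)`. -/
noncomputable def nextAmp (Φ : ℝ → ℝ) (m : ℝ) (A : ℝ → ℝ) (s : ℝ) : ℝ :=
  (m * A s + 2 * s * deriv A s) / (2 * deriv Φ s)

theorem hasDerivAt_pow_mul_comp_sq {A : ℝ → ℝ} {r : ℝ} (m : ℕ)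
    (hA : ContDiffAt ℝ (⊤ : ℕ∞) A (r ^ 2)) :
    HasDerivAt (fun r => r ^ m * A (r ^ 2))
      (m * r ^ (m - 1) * A (r ^ 2) + r ^ m * (2 * r * deriv A (r ^ 2))) r := by
  have hs : HasDerivAt (fun r : ℝ => r ^ 2) (2 * r) r := by simpa using hasDerivAt_pow 2 r
  have hA' : HasDerivAt A (deriv A (r ^ 2)) (r ^ 2) := (hA.differentiableAt (by simp)).hasDerivAt
  refine ((hasDerivAt_pow m r).mul
    (HasDerivAt.comp (h₂ := A) (h := fun r : ℝ => r ^ 2) r hA' hs)).congr_deriv ?_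
  simp only [Function.comp]
  ring

namespace RadialPhase

variable {Φ A : ℝ → ℝ}

theorem contDiffAt_nextAmp (hΦ : RadialPhase Φ) (m : ℝ) {s : ℝ} (hs : deriv Φ s ≠ 0)
    (hA : ContDiffAt ℝ (⊤ : ℕ∞) A s) : ContDiffAt ℝ (⊤ : ℕ∞) (nextAmp Φ m A) s :=
  ((contDiffAt_const.mul hA).add ((contDiffAt_const.mul contDiffAt_id).mul
    (ContDiffAt.derivWithin hA (by simp)))).div
      (contDiffAt_const.mul hΦ.contDiff_deriv.contDiffAt) (mul_ne_zero two_ne_zero hs)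

theorem smoothOnUnit_nextAmp (hΦ : RadialPhase Φ) (m : ℝ) (hA : SmoothOnUnit A) :
    SmoothOnUnit (nextAmp Φ m A) := fun s hs =>
  hΦ.contDiffAt_nextAmp m (hΦ.deriv_neg s hs).ne (hA s hs)

theorem nextAmp_zero_ne_zero (hΦ : RadialPhase Φ) {m : ℝ} (hm : m ≠ 0) (hA : A 0 ≠ 0) :
    nextAmp Φ m A 0 ≠ 0 := by
  have := (hΦ.deriv_neg 0 ⟨le_rfl, zero_le_one⟩).ne
  simp [nextAmp, hm, hA, this]

/-- The oscillatory integral with amplitude `f φ'`, where `f r = r ^ m * A (r ^ 2)` and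
`φ r = Φ (r ^ 2)`. -/
noncomputable def oscIntegral (Φ h : ℝ → ℝ) (m : ℕ) (A : ℝ → ℝ) (ξ : ℝ) : ℝ :=
  ∫ r in (0 : ℝ)..1, h (ξ * Φ (r ^ 2)) * (r ^ m * A (r ^ 2) * (2 * r * deriv Φ (r ^ 2)))

theorem smoothOnUnit_derivFactor (m : ℕ) (hA : SmoothOnUnit A) :
    SmoothOnUnit fun r => m * r ^ (m - 1) * A (r ^ 2) + r ^ m * (2 * r * deriv A (r ^ 2)) :=
  ((((contDiff_const.mul (contDiff_id.pow (m - 1))).smoothOnUnit).mul hA.comp_sq).add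
    ((contDiff_id.pow m).smoothOnUnit.mul
      ((contDiff_const.mul contDiff_id).smoothOnUnit.mul hA.deriv.comp_sq)))

/-- The phase takes the values `ξ` at `r = 0` and `0` at `r = 1`, whence the arguments of the
primitive. The factor `0 ^ m` keeps the term from the origin exactly when `m = 0`; there the
truncated exponent `m - 1` is harmless because its coefficient is zero. -/
theorem mul_oscIntegral (hΦ : RadialPhase Φ) (h1 : Φ 1 = 0) {T : ℝ} (hT : 0 < T) {h : ℝ → ℝ}
    (hh : PeriodicMeanZero T h) (m : ℕ) (hA : SmoothOnUnit A) (ξ : ℝ) :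
    ξ * oscIntegral Φ h m A ξ = A 1 * meanZeroPrimitive T h 0
      - 0 ^ m * A 0 * meanZeroPrimitive T h ξ
      - ∫ r in (0 : ℝ)..1, meanZeroPrimitive T h (ξ * Φ (r ^ 2)) *
          (m * r ^ (m - 1) * A (r ^ 2) + r ^ m * (2 * r * deriv A (r ^ 2))) := by
  have hu : Set.uIcc (0 : ℝ) 1 = Set.Icc 0 1 := Set.uIcc_of_le zero_le_one
  have key := hΦ.integral_by_parts ξ 0 1 (hh.hasDerivAt_primitive hT) hh.continuous
    (fun r hr => hasDerivAt_pow_mul_comp_sq m (hA (r ^ 2) (sq_mem_unit (hu ▸ hr))))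
    (hu ▸ (smoothOnUnit_derivFactor m hA).continuousOn)
  rw [oscIntegral, key]
  simp [h1, hΦ.map_zero]

theorem mul_oscIntegral_add_two (hΦ : RadialPhase Φ) (h1 : Φ 1 = 0) {T : ℝ} (hT : 0 < T)
    {h : ℝ → ℝ} (hh : PeriodicMeanZero T h) (k : ℕ) (hA : SmoothOnUnit A) (ξ : ℝ) :
    ξ * oscIntegral Φ h (k + 2) A ξ = A 1 * meanZeroPrimitive T h 0
      - oscIntegral Φ (meanZeroPrimitive T h) k (nextAmp Φ (k + 2) A) ξ := by
  rw [hΦ.mul_oscIntegral h1 hT hh (k + 2) hA ξ, oscIntegral]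
  have : (0 : ℝ) ^ (k + 2) = 0 := by simp
  rw [this, zero_mul, zero_mul, sub_zero]
  congr 1
  refine intervalIntegral.integral_congr fun r hr => ?_
  rw [Set.uIcc_of_le zero_le_one] at hr
  have h2 := (hΦ.deriv_neg _ (sq_mem_unit hr)).ne
  simp only [nextAmp, show k + 2 - 1 = k + 1 by omega]
  push_cast
  field_simp
  ring

theorem tendsto_mul_oscIntegral (hΦ : RadialPhase Φ) (h1 : Φ 1 = 0) {T : ℝ} (hT : 0 < T)
    {h : ℝ → ℝ} (hh : PeriodicMeanZero T h) (m : ℕ) (hA : SmoothOnUnit A) :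
    Tendsto (fun ξ => ξ * oscIntegral Φ h m A ξ - (A 1 * meanZeroPrimitive T h 0
      - 0 ^ m * A 0 * meanZeroPrimitive T h ξ)) atTop (𝓝 0) := by
  have := (hΦ.tendsto_integral_zero hT (hh.primitive hT) (smoothOnUnit_derivFactor m hA)).neg
  rw [neg_zero] at this
  refine this.congr fun ξ => ?_
  rw [hΦ.mul_oscIntegral h1 hT hh m hA ξ]
  ring

theorem tendsto_oscIntegral (hΦ : RadialPhase Φ) {T : ℝ} (hT : 0 < T)
    {h : ℝ → ℝ} (hh : PeriodicMeanZero T h) (m : ℕ) (hA : SmoothOnUnit A) :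
    Tendsto (oscIntegral Φ h m A) atTop (𝓝 0) :=
  hΦ.tendsto_integral_zero hT hh (((contDiff_id.pow m).smoothOnUnit.mul hA.comp_sq).mul
    ((contDiff_const.mul contDiff_id).smoothOnUnit.mul hΦ.contDiff_deriv.smoothOnUnit.comp_sq))

/-- This is the remainder left by an amplitude `r A(r²)`: its derivative at the origin is `A 0 ≠ 0`,
so the remainder has no eventual sign. The weight keeps the unsimplified form produced by
`mul_oscIntegral` at `m = 1`. -/
theorem changesSign_integral_derivFactor_one (hΦ : RadialPhase Φ) {T : ℝ} (hT : 0 < T)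
    {h : ℝ → ℝ} (hh : PeriodicMeanZero T h) (hA : SmoothOnUnit A) (hA0 : A 0 ≠ 0) :
    ChangesSignInfinitelyOften fun ξ => ∫ r in (0 : ℝ)..1, h (ξ * Φ (r ^ 2)) *
      ((1 : ℕ) * r ^ (1 - 1) * A (r ^ 2) + r ^ 1 * (2 * r * deriv A (r ^ 2))) :=
  hΦ.changesSignInfinitelyOften_integral hT hh (smoothOnUnit_derivFactor 1 hA) (by simpa using hA0)

end RadialPhase

/-! ### The amplitudes and their values at the endpoints -/

/-- `f₁ r = r ^ (n - 2) * ampOne n (r ^ 2)`. -/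
noncomputable def ampOne (n : ℕ) (s : ℝ) : ℝ :=
  radialProfile n s / (2 * deriv (radialProfile n) s)

/-- `f₂ r = r ^ (n - 4) * ampTwo n (r ^ 2)`. -/
noncomputable def ampTwo (n : ℕ) : ℝ → ℝ := nextAmp (radialProfile n) (n - 2) (ampOne n)

/-- `f₃ r = r ^ (n - 6) * ampThree n (r ^ 2)`. -/
noncomputable def ampThree (n : ℕ) : ℝ → ℝ := nextAmp (radialProfile n) (n - 4) (ampTwo n)

section Amplitudes

variable {n : ℕ}

theorem contDiffAt_ampOne (hn : 1 ≤ n) {s : ℝ} (hs : deriv (radialProfile n) s ≠ 0) :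
    ContDiffAt ℝ (⊤ : ℕ∞) (ampOne n) s :=
  (contDiff_radialProfile hn).contDiffAt.div
    (contDiffAt_const.mul (contDiff_deriv_radialProfile hn).contDiffAt)
    (mul_ne_zero two_ne_zero hs)

theorem contDiffAt_ampTwo (hn : 1 ≤ n) {s : ℝ} (hs : deriv (radialProfile n) s ≠ 0) :
    ContDiffAt ℝ (⊤ : ℕ∞) (ampTwo n) s :=
  (radialPhase_radialProfile hn).contDiffAt_nextAmp _ hs (contDiffAt_ampOne hn hs)

theorem smoothOnUnit_ampOne (hn : 1 ≤ n) : SmoothOnUnit (ampOne n) := fun _ hs =>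
  contDiffAt_ampOne hn (deriv_radialProfile_neg hn hs).ne

theorem smoothOnUnit_ampTwo (hn : 1 ≤ n) : SmoothOnUnit (ampTwo n) :=
  (radialPhase_radialProfile hn).smoothOnUnit_nextAmp _ (smoothOnUnit_ampOne hn)

theorem smoothOnUnit_ampThree (hn : 1 ≤ n) : SmoothOnUnit (ampThree n) :=
  (radialPhase_radialProfile hn).smoothOnUnit_nextAmp _ (smoothOnUnit_ampTwo hn)

theorem deriv_radialProfile_zero_ne (hn : 1 ≤ n) : deriv (radialProfile n) 0 ≠ 0 :=
  (deriv_radialProfile_neg hn ⟨le_rfl, zero_le_one⟩).ne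

theorem deriv_radialProfile_one_ne (hn : 1 ≤ n) : deriv (radialProfile n) 1 ≠ 0 :=
  (deriv_radialProfile_neg hn ⟨zero_le_one, le_rfl⟩).ne

theorem ampOne_zero (hn : 1 ≤ n) : ampOne n 0 = 1 / (2 * deriv (radialProfile n) 0) := by
  rw [ampOne, radialProfile_zero hn]

theorem ampOne_zero_ne (hn : 1 ≤ n) : ampOne n 0 ≠ 0 := by
  rw [ampOne_zero hn]
  exact one_div_ne_zero (mul_ne_zero two_ne_zero (deriv_radialProfile_zero_ne hn))

theorem ampTwo_zero_ne (hn : 3 ≤ n) : ampTwo n 0 ≠ 0 := by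
  have h3 : (3 : ℝ) ≤ n := by exact_mod_cast hn
  exact (radialPhase_radialProfile (by omega)).nextAmp_zero_ne_zero (by linarith)
    (ampOne_zero_ne (by omega))

theorem ampThree_zero_ne (hn : 5 ≤ n) : ampThree n 0 ≠ 0 := by
  have h3 : (5 : ℝ) ≤ n := by exact_mod_cast hn
  exact (radialPhase_radialProfile (by omega)).nextAmp_zero_ne_zero (by linarith)
    (ampTwo_zero_ne (by omega))

theorem ampOne_one (hn : 1 ≤ n) : ampOne n 1 = 0 := by
  rw [ampOne, radialProfile_one hn, zero_div]

theorem hasDerivAt_ampOne (hn : 1 ≤ n) {s : ℝ} (hs : deriv (radialProfile n) s ≠ 0) :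
    HasDerivAt (ampOne n) (1 / 2 - ampOne n s *
      (deriv (deriv (radialProfile n)) s / deriv (radialProfile n) s)) s := by
  refine ((hasDerivAt_radialProfile hn s).div ((hasDerivAt_deriv_radialProfile hn s).const_mul 2)
    (mul_ne_zero two_ne_zero hs)).congr_deriv ?_
  rw [ampOne]
  field_simp

theorem deriv_ampOne_one (hn : 1 ≤ n) : deriv (ampOne n) 1 = 1 / 2 := by
  rw [(hasDerivAt_ampOne hn (deriv_radialProfile_one_ne hn)).deriv, ampOne_one hn]
  ring

/-- At `s = 1` only `-A₁' Φ''/Φ'` survives, as `A₁(1) = 0`; the equation at the zero of `Φ` gives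
`Φ''(1)/Φ'(1) = -n/2`, and `A₁'(1) = 1/2`. -/
theorem hasDerivAt_deriv_ampOne_one (hn : 1 ≤ n) :
    HasDerivAt (deriv (ampOne n)) (n / 4) 1 := by
  have h1 := deriv_radialProfile_one_ne hn
  have hc := contDiff_deriv_radialProfile hn
  have hcc := (contDiff_infty_iff_deriv.1 hc).2
  have hev : deriv (ampOne n) =ᶠ[𝓝 1] fun s => 1 / 2 - ampOne n s *
      (deriv (deriv (radialProfile n)) s / deriv (radialProfile n) s) :=
    (hc.continuous.continuousAt.eventually_ne h1).mono fun s hs => (hasDerivAt_ampOne hn hs).deriv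
  have hq : DifferentiableAt ℝ
      (fun s => deriv (deriv (radialProfile n)) s / deriv (radialProfile n) s) 1 :=
    (hcc.differentiable (by simp) 1).div (hc.differentiable (by simp) 1) h1
  refine (((hasDerivAt_ampOne hn h1).mul hq.hasDerivAt).const_sub (1 / 2)
    |>.congr_of_eventuallyEq hev).congr_deriv ?_
  have ho := radialProfile_ode hn 1
  rw [radialProfile_one hn] at ho
  rw [ampOne_one hn]
  have h2 : deriv (deriv (radialProfile n)) 1 = -(n / 2) * deriv (radialProfile n) 1 := by
    linarith
  rw [h2]
  field_simp
  ring

theorem ampTwo_one (hn : 1 ≤ n) : ampTwo n 1 = 1 / (2 * deriv (radialProfile n) 1) := by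
  rw [ampTwo, nextAmp, ampOne_one hn, deriv_ampOne_one hn]
  norm_num

theorem ampTwo_one_ne (hn : 1 ≤ n) : ampTwo n 1 ≠ 0 := by
  rw [ampTwo_one hn]
  exact one_div_ne_zero (mul_ne_zero two_ne_zero (deriv_radialProfile_one_ne hn))

theorem deriv_ampTwo_one (hn : 1 ≤ n) :
    deriv (ampTwo n) 1 = 3 * n / (4 * deriv (radialProfile n) 1) := by
  have h1 := deriv_radialProfile_one_ne hn
  have hA := hasDerivAt_ampOne hn h1
  have e1 : HasDerivAt (fun s : ℝ => 2 * s) 2 1 := by simpa using (hasDerivAt_id (1 : ℝ)).const_mul 2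
  have := (((hA.const_mul ((n : ℝ) - 2)).add (e1.mul (hasDerivAt_deriv_ampOne_one hn))).div
    ((hasDerivAt_deriv_radialProfile hn 1).const_mul 2) (mul_ne_zero two_ne_zero h1))
  refine (this.congr_deriv ?_).deriv
  have ho := radialProfile_ode hn 1
  rw [radialProfile_one hn] at ho
  have h2 : deriv (deriv (radialProfile n)) 1 = -(n / 2) * deriv (radialProfile n) 1 := by
    linarith
  simp only [Pi.mul_apply, Pi.add_apply]
  rw [ampOne_one hn, deriv_ampOne_one hn, h2]
  field_simp
  ring

/-- The value is `(n - 1)/Φ'(1)²`. It is the coefficient of `g₃(0)`, the leading term of `ξ³ K` for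
`n ≥ 7` when `g₂(0) = 0`. -/
theorem ampThree_one_ne (hn : 2 ≤ n) : ampThree n 1 ≠ 0 := by
  have h1 := deriv_radialProfile_one_ne (n := n) (by omega)
  have hn' : (2 : ℝ) ≤ n := by exact_mod_cast hn
  have : ampThree n 1 = (n - 1) / deriv (radialProfile n) 1 ^ 2 := by
    rw [ampThree, nextAmp, ampTwo_one (by omega), deriv_ampTwo_one (by omega)]
    field_simp
    ring
  rw [this]
  exact div_ne_zero (by linarith) (pow_ne_zero 2 h1)

theorem deriv_phiOne (hn : 1 ≤ n) (r : ℝ) :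
    deriv (phiOne n) r = 2 * r * deriv (radialProfile n) (r ^ 2) := by
  rw [show phiOne n = fun r => radialProfile n (r ^ 2) from funext (phiOne_eq n)]
  exact ((radialPhase_radialProfile hn).hasDerivAt_comp_sq r).deriv

theorem deriv_deriv_phiOne_zero (hn : 1 ≤ n) :
    deriv (deriv (phiOne n)) 0 = 2 * deriv (radialProfile n) 0 := by
  rw [show deriv (phiOne n) = fun r => r ^ 1 * (2 * deriv (radialProfile n) (r ^ 2)) from
    funext fun r => by rw [deriv_phiOne hn]; ring]
  refine ((hasDerivAt_pow_mul_comp_sq (A := fun s => 2 * deriv (radialProfile n) s) 1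
    (contDiff_const.mul (contDiff_deriv_radialProfile hn)).contDiffAt).deriv).trans ?_
  simp

theorem fOne_eq (hn : 2 ≤ n) {r : ℝ} (hr : r ≠ 0) :
    fOne n r = r ^ (n - 2) * ampOne n (r ^ 2) := by
  obtain ⟨m, rfl⟩ : ∃ m, n = m + 2 := ⟨n - 2, by omega⟩
  rw [fOne, deriv_phiOne (by omega), phiOne_eq, ampOne, show m + 2 - 1 = m + 1 by omega,
    Nat.add_sub_cancel]
  -- Where `Φ'` vanishes both sides are zero, by the convention for division by zero.
  by_cases h : deriv (radialProfile (m + 2)) (r ^ 2) = 0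
  · simp [h]
  · field_simp
    ring

/-- The formula for `F` is needed on a neighbourhood, since `deriv` depends on the germ. The set
`isOpen_regular` serves rather than `(0, 1)` because `f₃` is also evaluated at `r = 1`. -/
theorem deriv_div_deriv_phiOne {U : Set ℝ} (hU : IsOpen U) (hn : 1 ≤ n) {k : ℕ} {F A : ℝ → ℝ}
    (hF : ∀ r ∈ U, F r = r ^ (k + 2) * A (r ^ 2)) {r : ℝ} (hr : r ∈ U) (hr0 : r ≠ 0)
    (hA : ContDiffAt ℝ (⊤ : ℕ∞) A (r ^ 2)) :
    deriv F r / deriv (phiOne n) r = r ^ k * nextAmp (radialProfile n) (k + 2) A (r ^ 2) := by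
  have hev : F =ᶠ[𝓝 r] fun r => r ^ (k + 2) * A (r ^ 2) := (hU.eventually_mem hr).mono hF
  rw [hev.deriv_eq, (hasDerivAt_pow_mul_comp_sq (k + 2) hA).deriv, deriv_phiOne hn, nextAmp,
    show k + 2 - 1 = k + 1 by omega]
  push_cast
  by_cases h : deriv (radialProfile n) (r ^ 2) = 0
  · simp [h]
  · field_simp
    ring

theorem isOpen_regular (hn : 1 ≤ n) :
    IsOpen {r : ℝ | r ≠ 0 ∧ deriv (radialProfile n) (r ^ 2) ≠ 0} :=
  isOpen_ne.inter (isOpen_ne.preimage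
    ((contDiff_deriv_radialProfile hn).continuous.comp (continuous_pow 2)))

theorem fTwo_eq (hn : 4 ≤ n) {r : ℝ} (hr : r ≠ 0) (hd : deriv (radialProfile n) (r ^ 2) ≠ 0) :
    fTwo n r = r ^ (n - 4) * ampTwo n (r ^ 2) := by
  have hU : ∀ r ∈ {r : ℝ | r ≠ 0 ∧ deriv (radialProfile n) (r ^ 2) ≠ 0},
      fOne n r = r ^ (n - 4 + 2) * ampOne n (r ^ 2) := fun r hr => by
    rw [fOne_eq (by omega) hr.1, show n - 2 = n - 4 + 2 by omega]
  rw [fTwo, deriv_div_deriv_phiOne (isOpen_regular (by omega)) (by omega) hU ⟨hr, hd⟩ hr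
    (contDiffAt_ampOne (by omega) hd), ampTwo, Nat.cast_sub hn]
  congr 2
  push_cast
  ring

theorem fThree_eq (hn : 6 ≤ n) {r : ℝ} (hr : r ≠ 0) (hd : deriv (radialProfile n) (r ^ 2) ≠ 0) :
    fThree n r = r ^ (n - 6) * ampThree n (r ^ 2) := by
  have hU : ∀ r ∈ {r : ℝ | r ≠ 0 ∧ deriv (radialProfile n) (r ^ 2) ≠ 0},
      fTwo n r = r ^ (n - 6 + 2) * ampTwo n (r ^ 2) := fun r hr => by
    rw [fTwo_eq (by omega) hr.1 hr.2, show n - 4 = n - 6 + 2 by omega]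
  rw [fThree, deriv_div_deriv_phiOne (isOpen_regular (by omega)) (by omega) hU ⟨hr, hd⟩ hr
    (contDiffAt_ampTwo (by omega) hd), ampThree, Nat.cast_sub hn]
  congr 2
  push_cast
  ring

end Amplitudes

/-! ### The integral `K` in each dimension -/

open RadialPhase

section Reduction

variable {n : ℕ} {T : ℝ} {g : ℝ → ℝ}

theorem oscK_eq_oscIntegral (hn : 2 ≤ n) (ξ : ℝ) :
    oscK n g ξ = oscIntegral (radialProfile n) g (n - 2) (ampOne n) ξ := by
  obtain ⟨m, rfl⟩ : ∃ m, n = m + 2 := ⟨n - 2, by omega⟩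
  rw [oscK, oscIntegral]
  refine intervalIntegral.integral_congr fun r hr => ?_
  rw [Set.uIcc_of_le zero_le_one] at hr
  have h := (deriv_radialProfile_neg (n := m + 2) (by omega) (sq_mem_unit hr)).ne
  simp only [phiOne_eq, ampOne, Nat.add_sub_cancel, show m + 2 - 1 = m + 1 by omega]
  field_simp
  ring

theorem mul_oscK (hn : 4 ≤ n) (hT : 0 < T) (hg : PeriodicMeanZero T g) (ξ : ℝ) :
    ξ * oscK n g ξ =
      -oscIntegral (radialProfile n) (meanZeroPrimitive T g) (n - 4) (ampTwo n) ξ := by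
  have h := (radialPhase_radialProfile (n := n) (by omega)).mul_oscIntegral_add_two
    (radialProfile_one (by omega)) hT hg (n - 4) (smoothOnUnit_ampOne (n := n) (by omega)) ξ
  rw [ampOne_one (by omega), zero_mul, zero_sub, Nat.cast_sub hn,
    show n - 4 + 2 = n - 2 by omega, ← oscK_eq_oscIntegral (by omega)] at h
  rw [h, ampTwo]
  congr 3
  push_cast
  ring

theorem sq_mul_oscK (hn : 6 ≤ n) (hT : 0 < T) (hg : PeriodicMeanZero T g) (ξ : ℝ) :
    ξ ^ 2 * oscK n g ξ =
      -(ampTwo n 1 * meanZeroPrimitive T (meanZeroPrimitive T g) 0) +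
      oscIntegral (radialProfile n) (meanZeroPrimitive T (meanZeroPrimitive T g)) (n - 6)
        (ampThree n) ξ := by
  have h := (radialPhase_radialProfile (n := n) (by omega)).mul_oscIntegral_add_two
    (radialProfile_one (by omega)) hT (hg.primitive hT) (n - 6)
    (smoothOnUnit_ampTwo (n := n) (by omega)) ξ
  rw [show n - 6 + 2 = n - 4 by omega, Nat.cast_sub hn] at h
  rw [sq, mul_assoc, mul_oscK (by omega) hT hg, mul_neg, h, ampThree,
    show (n : ℝ) - (6 : ℕ) + 2 = n - 4 by push_cast; ring]
  ring

/-- No integration by parts is needed: the weight is `φ₁` itself, equal to `1` at the origin. -/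
theorem changesSign_oscK_one (hT : 0 < T) (hg : PeriodicMeanZero T g) :
    ChangesSignInfinitelyOften (oscK 1 g) := by
  have h := (radialPhase_radialProfile (le_refl 1)).changesSignInfinitelyOften_integral hT hg
    (w := fun r => radialProfile 1 (r ^ 2)) (contDiff_radialProfile le_rfl).smoothOnUnit.comp_sq
    (by simp [radialProfile_zero])
  convert h using 2 with ξ
  rw [oscK]
  simp [phiOne_eq]

theorem changesSign_oscK_two (hT : 0 < T) (hg : PeriodicMeanZero T g) :
    ChangesSignInfinitelyOften (oscK 2 g) := by
  have hP := hg.primitive hT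
  have h := (radialPhase_radialProfile one_le_two).tendsto_mul_oscIntegral
    (radialProfile_one one_le_two) hT hg 0 (smoothOnUnit_ampOne one_le_two)
  refine ChangesSignInfinitelyOften.of_asymptotic hT
    (P := fun ξ => -ampOne 2 0 * meanZeroPrimitive T g ξ) (p := fun ξ => ξ)
    (fun ξ => by simp only [hP.periodic ξ])
    (hP.changesSignInfinitelyOften_const_mul hT (neg_ne_zero.2 (ampOne_zero_ne one_le_two)))
    (fun ξ hξ => hξ) (h.congr fun ξ => ?_)
  rw [oscK_eq_oscIntegral le_rfl, ampOne_one one_le_two]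
  ring

theorem changesSign_oscK_three (hT : 0 < T) (hg : PeriodicMeanZero T g) :
    ChangesSignInfinitelyOften (oscK 3 g) := by
  have h3 : 1 ≤ 3 := by norm_num
  have hΦ := radialPhase_radialProfile h3
  refine (hΦ.changesSign_integral_derivFactor_one hT (hg.primitive hT).neg
    (smoothOnUnit_ampOne h3) (ampOne_zero_ne h3)).of_mul_eq (p := fun ξ => ξ)
    (fun ξ hξ => hξ) fun ξ _ => ?_
  rw [oscK_eq_oscIntegral (by norm_num), hΦ.mul_oscIntegral (radialProfile_one h3) hT hg (3 - 2)
    (smoothOnUnit_ampOne h3), ampOne_one h3]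
  simp

/-- The second integration by parts has exponent zero, so both ends contribute: `A₂(1) = 1/φ₁'(1)`
and `A₂(0) = 2/φ₁''(0)²`. -/
theorem tendsto_oscK_four (hT : 0 < T) (hg : PeriodicMeanZero T g) :
    Tendsto (fun ξ => ξ ^ 2 * oscK 4 g ξ -
      compareFour (meanZeroPrimitive T (meanZeroPrimitive T g)) ξ) atTop (𝓝 0) := by
  have h4 : 1 ≤ 4 := by norm_num
  have h := ((radialPhase_radialProfile h4).tendsto_mul_oscIntegral
    (radialProfile_one h4) hT (hg.primitive hT) 0 (smoothOnUnit_ampTwo h4)).neg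
  rw [neg_zero] at h
  refine h.congr fun ξ => ?_
  have h0 := deriv_radialProfile_zero_ne h4
  have hB0 : ampTwo 4 0 = 2 / (2 * deriv (radialProfile 4) 0) ^ 2 := by
    rw [ampTwo, nextAmp, ampOne_zero h4]
    field_simp
    norm_num
  rw [sq, mul_assoc ξ ξ, mul_oscK le_rfl hT hg, compareFour, deriv_phiOne h4,
    deriv_deriv_phiOne_zero h4, hB0, ampTwo_one h4]
  simp
  ring

/-- The remaining integral tends to zero, so the constant decides the sign of `K` unless `g₂(0) =
0`; then the integral alone remains, with weight `A₂(0) ≠ 0` at the origin. -/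
theorem sq_mul_oscK_five (hT : 0 < T) (hg : PeriodicMeanZero T g) (ξ : ℝ) :
    ξ ^ 2 * oscK 5 g ξ = -(ampTwo 5 1 * meanZeroPrimitive T (meanZeroPrimitive T g) 0)
      + ∫ r in (0 : ℝ)..1, meanZeroPrimitive T (meanZeroPrimitive T g)
          (ξ * radialProfile 5 (r ^ 2)) *
        ((1 : ℕ) * r ^ (1 - 1) * ampTwo 5 (r ^ 2)
          + r ^ 1 * (2 * r * deriv (ampTwo 5) (r ^ 2))) := by
  have h5 : 1 ≤ 5 := by norm_num
  rw [sq, mul_assoc, mul_oscK (by norm_num) hT hg, mul_neg,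
    (radialPhase_radialProfile h5).mul_oscIntegral (radialProfile_one h5) hT (hg.primitive hT)
      (5 - 4) (smoothOnUnit_ampTwo h5)]
  simp
  ring

theorem onlyFinitely_of_tendsto_const (hT : 0 < T) {F : ℝ → ℝ} {m : ℕ} {c : ℝ} (hc : c ≠ 0)
    (h : Tendsto (fun ξ => ξ ^ m * F ξ - c) atTop (𝓝 0)) : OnlyFinitelyManySignChanges F :=
  OnlyFinitelyManySignChanges.of_asymptotic hT (P := fun _ => c) (fun _ => rfl) continuous_const
    (fun _ _ => hc) (fun _ hξ => pow_pos hξ m) h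

theorem onlyFinitely_oscK_five (hT : 0 < T) (hg : PeriodicMeanZero T g)
    (h0 : meanZeroPrimitive T (meanZeroPrimitive T g) 0 ≠ 0) :
    OnlyFinitelyManySignChanges (oscK 5 g) := by
  have h5 : 1 ≤ 5 := by norm_num
  refine onlyFinitely_of_tendsto_const hT (m := 2) (neg_ne_zero.2 (mul_ne_zero (ampTwo_one_ne h5) h0))
    (((radialPhase_radialProfile h5).tendsto_integral_zero hT ((hg.primitive hT).primitive hT)
      (smoothOnUnit_derivFactor 1 (smoothOnUnit_ampTwo h5))).congr fun ξ => ?_)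
  rw [sq_mul_oscK_five hT hg]
  ring

theorem changesSign_oscK_five (hT : 0 < T) (hg : PeriodicMeanZero T g)
    (h0 : meanZeroPrimitive T (meanZeroPrimitive T g) 0 = 0) :
    ChangesSignInfinitelyOften (oscK 5 g) := by
  have h5 : 1 ≤ 5 := by norm_num
  refine ((radialPhase_radialProfile h5).changesSign_integral_derivFactor_one hT
    ((hg.primitive hT).primitive hT) (smoothOnUnit_ampTwo h5)
    (ampTwo_zero_ne (by norm_num))).of_mul_eq (p := fun ξ => ξ ^ 2)
    (fun ξ hξ => pow_pos hξ 2) fun ξ _ => ?_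
  rw [sq_mul_oscK_five hT hg, h0, mul_zero, neg_zero, zero_add]

theorem onlyFinitely_oscK_of_six_le (hn : 6 ≤ n) (hT : 0 < T) (hg : PeriodicMeanZero T g)
    (h0 : meanZeroPrimitive T (meanZeroPrimitive T g) 0 ≠ 0) :
    OnlyFinitelyManySignChanges (oscK n g) := by
  have hn1 : 1 ≤ n := by omega
  refine onlyFinitely_of_tendsto_const hT (m := 2)
    (neg_ne_zero.2 (mul_ne_zero (ampTwo_one_ne hn1) h0))
    (((radialPhase_radialProfile hn1).tendsto_oscIntegral hT ((hg.primitive hT).primitive hT)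
      (n - 6) (smoothOnUnit_ampThree hn1)).congr fun ξ => ?_)
  rw [sq_mul_oscK hn hT hg]
  ring

/-- The third integration by parts reaches exponent zero only for `n = 6`; for larger `n` the
periodic term disappears. -/
theorem tendsto_cube_mul_oscK (hn : 6 ≤ n) (hT : 0 < T) (hg : PeriodicMeanZero T g)
    (h0 : meanZeroPrimitive T (meanZeroPrimitive T g) 0 = 0) :
    Tendsto (fun ξ => ξ ^ 3 * oscK n g ξ -
      (ampThree n 1 * meanZeroPrimitive T (meanZeroPrimitive T (meanZeroPrimitive T g)) 0
        - 0 ^ (n - 6) * ampThree n 0 *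
          meanZeroPrimitive T (meanZeroPrimitive T (meanZeroPrimitive T g)) ξ)) atTop (𝓝 0) := by
  have hn1 : 1 ≤ n := by omega
  refine ((radialPhase_radialProfile hn1).tendsto_mul_oscIntegral (radialProfile_one hn1) hT
    ((hg.primitive hT).primitive hT) (n - 6) (smoothOnUnit_ampThree hn1)).congr fun ξ => ?_
  rw [pow_succ' ξ 2, mul_assoc ξ (ξ ^ 2), sq_mul_oscK hn hT hg, h0, mul_zero, neg_zero, zero_add]

theorem fThree_six_one : fThree 6 1 = ampThree 6 1 := by
  rw [fThree_eq le_rfl one_ne_zero (by simpa using deriv_radialProfile_one_ne (by norm_num))]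
  simp

theorem tendsto_fThree_six : Tendsto (fThree 6) (𝓝[>] 0) (𝓝 (ampThree 6 0)) := by
  have h6 : 1 ≤ 6 := by norm_num
  have hc : ContinuousAt (fun r : ℝ => ampThree 6 (r ^ 2)) 0 :=
    ((smoothOnUnit_ampThree h6).comp_sq 0 ⟨le_rfl, zero_le_one⟩).continuousAt
  have hlim : Tendsto (fun r : ℝ => ampThree 6 (r ^ 2)) (𝓝[>] 0) (𝓝 (ampThree 6 0)) := by
    have := hc.tendsto
    simp only [ne_eq, OfNat.ofNat_ne_zero, not_false_eq_true, zero_pow] at this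
    exact this.mono_left nhdsWithin_le_nhds
  refine hlim.congr' ?_
  filter_upwards [Ioo_mem_nhdsGT (zero_lt_one' ℝ)] with r hr
  rw [fThree_eq le_rfl hr.1.ne'
    (deriv_radialProfile_neg h6 (sq_mem_unit ⟨hr.1.le, hr.2.le⟩)).ne]
  simp

theorem tendsto_oscK_six (hT : 0 < T) (hg : PeriodicMeanZero T g)
    (h0 : meanZeroPrimitive T (meanZeroPrimitive T g) 0 = 0) :
    Tendsto (fun ξ => ξ ^ 3 * oscK 6 g ξ - compareSix (ampThree 6 0)
      (meanZeroPrimitive T (meanZeroPrimitive T (meanZeroPrimitive T g))) ξ) atTop (𝓝 0) := by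
  simpa [compareSix, fThree_six_one] using tendsto_cube_mul_oscK le_rfl hT hg h0

theorem onlyFinitely_oscK_of_seven_le (hn : 7 ≤ n) (hT : 0 < T) (hg : PeriodicMeanZero T g)
    (h0 : meanZeroPrimitive T (meanZeroPrimitive T g) 0 = 0)
    (h1 : meanZeroPrimitive T (meanZeroPrimitive T (meanZeroPrimitive T g)) 0 ≠ 0) :
    OnlyFinitelyManySignChanges (oscK n g) := by
  refine onlyFinitely_of_tendsto_const hT (m := 3)
    (mul_ne_zero (ampThree_one_ne (by omega : 2 ≤ n)) h1) ?_
  simpa [show n - 6 ≠ 0 by omega] using tendsto_cube_mul_oscK (n := n) (by omega) hT hg h0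

end Reduction

/-! ### Assembly of the cases -/

theorem theorem2p2 (n : ℕ) (hn : 1 ≤ n) (g g₁ g₂ g₃ : ℝ → ℝ) (T : ℝ) (hT : 0 < T)
    (hg : ContDiff ℝ 1 g) (hper : Function.Periodic g T)
    (hmean : ∫ u in (0 : ℝ)..T, g u = 0) (hne : ∃ u, g u ≠ 0)
    (hg₁ : g₁ = meanZeroPrimitive T g) (hg₂ : g₂ = meanZeroPrimitive T g₁)
    (hg₃ : g₃ = meanZeroPrimitive T g₂) :
    (n ≤ 3 → ChangesSignInfinitelyOften (oscK n g)) ∧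
    (n = 4 →
      (g₂ 0 = 0 → ChangesSignInfinitelyOften (compareFour g₂)) ∧
      (ChangesSignInfinitelyOften (compareFour g₂) → ChangesSignInfinitelyOften (oscK n g)) ∧
      ((∀ ξ > 0, compareFour g₂ ξ ≠ 0) → OnlyFinitelyManySignChanges (oscK n g))) ∧
    (n = 5 →
      (g₂ 0 ≠ 0 → OnlyFinitelyManySignChanges (oscK n g)) ∧
      (g₂ 0 = 0 → ChangesSignInfinitelyOften (oscK n g))) ∧
    (n = 6 →
      (g₂ 0 ≠ 0 → OnlyFinitelyManySignChanges (oscK n g)) ∧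
      ∃ c : ℝ, Tendsto (fThree 6) (𝓝[>] 0) (𝓝 c) ∧
        (g₂ 0 = 0 →
          (g₃ 0 = 0 → ChangesSignInfinitelyOften (compareSix c g₃)) ∧
          (ChangesSignInfinitelyOften (compareSix c g₃) →
            ChangesSignInfinitelyOften (oscK n g)) ∧
          ((∀ ξ > 0, compareSix c g₃ ξ ≠ 0) → OnlyFinitelyManySignChanges (oscK n g)))) ∧
    (7 ≤ n → g₂ 0 = 0 → g₃ 0 ≠ 0 → OnlyFinitelyManySignChanges (oscK n g)) := by
  have hG : PeriodicMeanZero T g := ⟨hg.continuous, hper, hmean, hne⟩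
  subst hg₁ hg₂ hg₃
  have hG₂ := (hG.primitive hT).primitive hT
  have hG₃ := hG₂.primitive hT
  refine ⟨fun h => ?_, ?_, ?_, ?_, fun h => onlyFinitely_oscK_of_seven_le h hT hG⟩
  · interval_cases n
    · exact changesSign_oscK_one hT hG
    · exact changesSign_oscK_two hT hG
    · exact changesSign_oscK_three hT hG
  · rintro rfl
    have hP : Function.Periodic
        (compareFour (meanZeroPrimitive T (meanZeroPrimitive T g))) T := fun ξ => by
      simp only [compareFour, hG₂.periodic ξ]
    have hc : Continuous (compareFour (meanZeroPrimitive T (meanZeroPrimitive T g))) :=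
      continuous_const.add (continuous_const.mul hG₂.continuous)
    refine ⟨fun h0 => ?_, fun h => ?_, fun h => ?_⟩
    · have hd : (2 : ℝ) / deriv (deriv (phiOne 4)) 0 ^ 2 ≠ 0 := by
        rw [deriv_deriv_phiOne_zero hn]
        exact div_ne_zero two_ne_zero
          (pow_ne_zero 2 (mul_ne_zero two_ne_zero (deriv_radialProfile_zero_ne hn)))
      convert hG₂.changesSignInfinitelyOften_const_mul hT hd using 2 with ξ
      rw [compareFour, h0, mul_zero, zero_add]
    · exact h.of_asymptotic hT hP (fun ξ hξ => pow_pos hξ 2) (tendsto_oscK_four hT hG)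
    · exact .of_asymptotic hT hP hc h (fun ξ hξ => pow_pos hξ 2) (tendsto_oscK_four hT hG)
  · rintro rfl
    exact ⟨onlyFinitely_oscK_five hT hG, changesSign_oscK_five hT hG⟩
  · rintro rfl
    refine ⟨onlyFinitely_oscK_of_six_le le_rfl hT hG, ampThree 6 0, tendsto_fThree_six,
      fun h0 => ?_⟩
    have hP : Function.Periodic (compareSix (ampThree 6 0)
        (meanZeroPrimitive T (meanZeroPrimitive T (meanZeroPrimitive T g)))) T := fun ξ => by
      simp only [compareSix, hG₃.periodic ξ]
    have hc : Continuous (compareSix (ampThree 6 0)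
        (meanZeroPrimitive T (meanZeroPrimitive T (meanZeroPrimitive T g)))) :=
      continuous_const.sub (continuous_const.mul hG₃.continuous)
    refine ⟨fun h3 => ?_, fun h => ?_, fun h => ?_⟩
    · convert hG₃.changesSignInfinitelyOften_const_mul hT
        (neg_ne_zero.2 (ampThree_zero_ne (n := 6) (by norm_num))) using 2 with ξ
      rw [compareSix, h3, mul_zero, zero_sub, neg_mul]
    · exact h.of_asymptotic hT hP (fun ξ hξ => pow_pos hξ 3) (tendsto_oscK_six hT hG h0)
    · exact .of_asymptotic hT hP hc h (fun ξ hξ => pow_pos hξ 3) (tendsto_oscK_six hT hG h0)
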